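/- A two-day auction has one buyer and two items, one sold on each day. An instance consists of $n$ buyer types with first-day valuations $v^1_1,\dots,v^1_n\ge 0$, second-day valuations $v^2_1,\dots,v^2_m\ge 0$, and a joint probability distribution $(\pi_{ij})$ of type and second-day valuation, all rational, such that every type and every second-day valuation has positive probability. On day one the buyer knows only her type; she learns her second-day valuation on day two. The days are independent if $\pi_{ij}=\big(\sum_{j'}\pi_{ij'}\big)\big(\sum_{i'}\pi_{i'j}\big)$ for all $i,j$. A deterministic mechanism asks for the type $i$ on day one and decides whether the first item is allocated and at which price; it asks for the second-day valuation $j$ on day two and decides, depending on $(i,j)$, whether the second item is allocated and at which price. Nothing is paid for an item that is not allocated. The mechanism is incentive compatible if no type can increase her expected utility by any plan of misreports on the two days, and ex post individually rational if a truthful buyer never pays more for an item than her value for it. Its revenue is the expected total payment of a truthful buyer. It is semi-adaptive if it is given by two prices $p_i,q_i\in[0,\infty]$ for each reported type $i$: the first item is allocated at price $p_i$ if and only if $p_i\le v^1_i$, and the second item is allocated at price $q_i$ if and only if $q_i$ is at most the reported second-day valuation. **Theorem.** There is an algorithm which, given an instance with independent days (all numbers written in binary), computes, in time polynomial in the bit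 size of the instance, prices $p_i,q_i\in\mathbb{Q}_{\ge 0}\cup\{\infty\}$ for all types $i$ such that the semi-adaptive mechanism with these prices is incentive compatible and ex post individually rational and has the maximum revenue among all deterministic, incentive compatible and ex post individually rational mechanisms. -/

import Mathlib

/-! ## A model of computation with a step count

Programs act on finite binary trees whose leaves are integers written in binary.
Every instruction is charged at least the total bit size of the data it touches, so that a run of
cost `t` can be simulated by a Turing machine in time polynomial in `t` (and conversely). -/

/-- The data: integers and ordered pairs. -/
inductive Data : Type
  | int (z : ℤ) : Data
  | pair (a b : Data) : Data

namespace Data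

/-- Bit size: a leaf costs its binary length plus one, a pair costs one more than its parts. -/
def size : Data → ℕ
  | int z => 1 + z.natAbs.size
  | pair a b => 1 + a.size + b.size

/-- First component (`0` on a leaf). -/
def fst : Data → Data
  | int _ => int 0
  | pair a _ => a

/-- Second component (`0` on a leaf). -/
def snd : Data → Data
  | int _ => int 0
  | pair _ b => b

/-- The integer at a leaf (`0` on a pair). -/
def toInt : Data → ℤ
  | int z => z
  | pair _ _ => 0

/-- Whether the datum is a pair, as an integer `0` or `1`. -/
def isPair : Data → Data
  | int _ => int 0
  | pair _ _ => int 1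

/-- Lists: `[]` is the leaf `0`, and `a :: l` is the pair of `a` and `l`. -/
def ofList : List Data → Data
  | [] => int 0
  | a :: l => pair a (ofList l)

/-- A rational number is written as its numerator and denominator in lowest terms. -/
def ofRat (r : ℚ) : Data := pair (int r.num) (int r.den)

end Data

/-- The primitive instructions. The arithmetic ones act on a pair of integers. -/
inductive Op : Type
  | id : Op
  | const (z : ℤ) : Op
  | fst : Op
  | snd : Op
  | isPair : Op
  | add : Op
  | sub : Op
  | mul : Op
  | div : Op
  | le : Op

/-- The result of a primitive instruction. -/
def Op.apply : Op → Data → Data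
  | Op.id, x => x
  | Op.const z, _ => Data.int z
  | Op.fst, x => x.fst
  | Op.snd, x => x.snd
  | Op.isPair, x => x.isPair
  | Op.add, x => Data.int (x.fst.toInt + x.snd.toInt)
  | Op.sub, x => Data.int (x.fst.toInt - x.snd.toInt)
  | Op.mul, x => Data.int (x.fst.toInt * x.snd.toInt)
  | Op.div, x => Data.int (x.fst.toInt / x.snd.toInt)
  | Op.le, x => Data.int (if x.fst.toInt ≤ x.snd.toInt then 1 else 0)

/-- Programs. `comp f g` runs `g`, then `f`; `pair f g` runs both on the same input;
`ite c f g` runs the test `c`, then `f` if the test gave a nonzero integer and `g` otherwise;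
`loop c f` replaces `x` by the result of `f` on `x` as long as the test `c` is nonzero on `x`. -/
inductive Prog : Type
  | op (o : Op) : Prog
  | pair (f g : Prog) : Prog
  | comp (f g : Prog) : Prog
  | ite (c f g : Prog) : Prog
  | loop (c f : Prog) : Prog

/-- `Prog.Run f x y t`: on input `x` the program `f` halts with output `y` at total cost `t`. -/
inductive Prog.Run : Prog → Data → Data → ℕ → Prop
  | op (o : Op) (x : Data) : Prog.Run (Prog.op o) x (o.apply x) (x.size + 1)
  | pair {f g : Prog} {x a b : Data} {s t : ℕ} (hf : Prog.Run f x a s) (hg : Prog.Run g x b t) :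
      Prog.Run (Prog.pair f g) x (Data.pair a b) (s + t + x.size + 1)
  | comp {f g : Prog} {x y z : Data} {s t : ℕ} (hg : Prog.Run g x y s) (hf : Prog.Run f y z t) :
      Prog.Run (Prog.comp f g) x z (s + t + 1)
  | ite_pos {c f g : Prog} {x b y : Data} {s t : ℕ} (hc : Prog.Run c x b s) (hb : b.toInt ≠ 0)
      (hf : Prog.Run f x y t) : Prog.Run (Prog.ite c f g) x y (s + t + x.size + 1)
  | ite_neg {c f g : Prog} {x b y : Data} {s t : ℕ} (hc : Prog.Run c x b s) (hb : b.toInt = 0)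
      (hg : Prog.Run g x y t) : Prog.Run (Prog.ite c f g) x y (s + t + x.size + 1)
  | loop_stop {c f : Prog} {x b : Data} {s : ℕ} (hc : Prog.Run c x b s) (hb : b.toInt = 0) :
      Prog.Run (Prog.loop c f) x x (s + x.size + 1)
  | loop_step {c f : Prog} {x b y z : Data} {s t u : ℕ} (hc : Prog.Run c x b s)
      (hb : b.toInt ≠ 0) (hf : Prog.Run f x y t) (hl : Prog.Run (Prog.loop c f) y z u) :
      Prog.Run (Prog.loop c f) x z (s + t + u + x.size + 1)

/-- The search problem "given `a` with `promise a`, find some `y` with `sol a y`" is solved by one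
program whose running time is bounded by a polynomial in the bit size of the input. -/
def SolvableInPolyTime {α : Type} (encode : α → Data) (promise : α → Prop)
    (sol : α → Data → Prop) : Prop :=
  ∃ (f : Prog) (P : Polynomial ℕ), ∀ a : α, promise a →
    ∃ (y : Data) (t : ℕ), f.Run (encode a) y t ∧ t ≤ P.eval (encode a).size ∧ sol a y

/-! ## The two-day auction -/

/-- An instance: `n` buyer types with first-day valuations `v₁`, the `m` possible second-day
valuations `v₂`, and the joint probability of each pair. -/
structure TwoDayAuction : Type where
  n : ℕ
  m : ℕ
  v₁ : Fin n → ℚ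
  v₂ : Fin m → ℚ
  prob : Fin n → Fin m → ℚ

namespace TwoDayAuction

/-- The marginal probability of the `i`th type. -/
def prob₁ (I : TwoDayAuction) (i : Fin I.n) : ℚ := ∑ j, I.prob i j

/-- The marginal probability of the `j`th second-day valuation. -/
def prob₂ (I : TwoDayAuction) (j : Fin I.m) : ℚ := ∑ i, I.prob i j

/-- Valuations are non-negative, `prob` is a probability distribution, and only types and
second-day valuations of positive probability are listed. -/
structure Valid (I : TwoDayAuction) : Prop where
  v₁_nonneg : ∀ i, 0 ≤ I.v₁ i
  v₂_nonneg : ∀ j, 0 ≤ I.v₂ j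
  prob_nonneg : ∀ i j, 0 ≤ I.prob i j
  prob_sum : ∑ i, ∑ j, I.prob i j = 1
  prob₁_pos : ∀ i, 0 < I.prob₁ i
  prob₂_pos : ∀ j, 0 < I.prob₂ j

/-- The valuations on the two days are independent. -/
def IndependentDays (I : TwoDayAuction) : Prop :=
  ∀ i j, I.prob i j = I.prob₁ i * I.prob₂ j

/-- The instance as input data: both lists of valuations and the table of joint probabilities. -/
def encode (I : TwoDayAuction) : Data :=
  Data.pair (Data.ofList (List.ofFn fun i => Data.ofRat (I.v₁ i)))
    (Data.pair (Data.ofList (List.ofFn fun j => Data.ofRat (I.v₂ j)))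
      (Data.ofList (List.ofFn fun i => Data.ofList (List.ofFn fun j => Data.ofRat (I.prob i j)))))

/-- A deterministic (adaptive, direct) mechanism. The buyer reports her type on the first day and
her second-day valuation on the second day. Each day's report, with the history, determines
whether she gets the item of that day (`x₁`, `x₂`), and at which price (`p₁`, `p₂`); nothing is
paid for an item that is not allocated. -/
structure Mechanism (I : TwoDayAuction) : Type where
  x₁ : Fin I.n → Bool
  p₁ : Fin I.n → ℝ
  x₂ : Fin I.n → Fin I.m → Bool
  p₂ : Fin I.n → Fin I.m → ℝ

namespace Mechanism

variable {I : TwoDayAuction}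

/-- First-day utility with true value `v` and reported type `i`. -/
noncomputable def utility₁ (M : Mechanism I) (v : ℝ) (i : Fin I.n) : ℝ :=
  if M.x₁ i then v - M.p₁ i else 0

/-- Second-day utility with true value `v`, after the reports `i` and `j`. -/
noncomputable def utility₂ (M : Mechanism I) (v : ℝ) (i : Fin I.n) (j : Fin I.m) : ℝ :=
  if M.x₂ i j then v - M.p₂ i j else 0

/-- Expected utility, on the first day, of a buyer of type `i` who reports type `i'` on the first
day, and on the second day reports `σ j` whenever her true valuation is the `j`th one. -/
noncomputable def expectedUtility (M : Mechanism I) (i i' : Fin I.n) (σ : Fin I.m → Fin I.m) : ℝ :=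
  M.utility₁ (I.v₁ i) i' +
    ∑ j, ((I.prob i j / I.prob₁ i : ℚ) : ℝ) * M.utility₂ (I.v₂ j) i' (σ j)

/-- Incentive compatibility: no type gains in expectation by any plan of misreports on the two
days. -/
def IncentiveCompatible (M : Mechanism I) : Prop :=
  ∀ (i i' : Fin I.n) (σ : Fin I.m → Fin I.m),
    M.expectedUtility i i' σ ≤ M.expectedUtility i i (fun j => j)

/-- Ex post individual rationality: a truthful buyer never pays more for an item than its value
to her. -/
def ExPostIR (M : Mechanism I) : Prop :=
  (∀ i, M.x₁ i = true → M.p₁ i ≤ I.v₁ i) ∧ (∀ i j, M.x₂ i j = true → M.p₂ i j ≤ I.v₂ j)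

/-- Expected revenue from a truthful buyer. -/
noncomputable def revenue (M : Mechanism I) : ℝ :=
  ∑ i, ∑ j, (I.prob i j : ℝ) *
    ((if M.x₁ i then M.p₁ i else 0) + (if M.x₂ i j then M.p₂ i j else 0))

/-- Optimal among all deterministic, incentive compatible and ex post individually rational
mechanisms. -/
def IsOptimal (M : Mechanism I) : Prop :=
  M.IncentiveCompatible ∧ M.ExPostIR ∧
    ∀ M' : Mechanism I, M'.IncentiveCompatible → M'.ExPostIR → M'.revenue ≤ M.revenue

end Mechanism

/-- The semi-adaptive mechanism which, when type `i` is reported, offers the first item at price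
`p i` and the second item at price `q i`; the price `⊤` means that the item is not offered. A buyer
gets an item if its price is at most her reported value for it. -/
def semiAdaptive (I : TwoDayAuction) (p q : Fin I.n → WithTop ℚ) : Mechanism I where
  x₁ i := decide (p i ≤ (I.v₁ i : WithTop ℚ))
  p₁ i := (((p i).untopD 0 : ℚ) : ℝ)
  x₂ i j := decide (q i ≤ (I.v₂ j : WithTop ℚ))
  p₂ i _ := (((q i).untopD 0 : ℚ) : ℝ)

end TwoDayAuction

/-- A datum represents a price: the leaf `0` is the infinite price, and a pair of integers `a`, `b`
with `0 < b` is the price `a / b`. -/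
inductive Data.IsPrice : Data → WithTop ℚ → Prop
  | top : Data.IsPrice (Data.int 0) ⊤
  | finite (a b : ℤ) (hb : 0 < b) :
      Data.IsPrice (Data.pair (Data.int a) (Data.int b)) (((a : ℚ) / (b : ℚ) : ℚ) : WithTop ℚ)

/-- A datum represents a price schedule: it is the list, over all types `i`, of the pairs of
prices `p i`, `q i`. -/
def Data.IsPriceSchedule {n : ℕ} (y : Data) (p q : Fin n → WithTop ℚ) : Prop :=
  ∃ a b : Fin n → Data, (∀ i, (a i).IsPrice (p i) ∧ (b i).IsPrice (q i)) ∧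
    y = Data.ofList (List.ofFn fun i => Data.pair (a i) (b i))

/-- A datum is a solution of the two-day auction: it lists non-negative (possibly infinite) prices
whose semi-adaptive mechanism is optimal among all deterministic mechanisms. -/
def TwoDayAuction.IsSolution (I : TwoDayAuction) (y : Data) : Prop :=
  ∃ p q : Fin I.n → WithTop ℚ, y.IsPriceSchedule p q ∧ (∀ i, 0 ≤ p i ∧ 0 ≤ q i) ∧
    (I.semiAdaptive p q).IsOptimal

/-! ## Functions computable in polynomial time -/

theorem Polynomial.eval_nat_mono (P : Polynomial ℕ) : Monotone fun n => P.eval n := by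
  intro a b h
  induction P using Polynomial.induction_on' with
  | add p q hp hq =>
    simp only [Polynomial.eval_add]
    exact Nat.add_le_add hp hq
  | monomial n c =>
    simp only [Polynomial.eval_monomial]
    exact Nat.mul_le_mul_left _ (Nat.pow_le_pow_left h n)

theorem Data.size_pos (x : Data) : 1 ≤ x.size := by
  cases x <;> simp only [Data.size] <;> omega

theorem Data.size_fst_le (x : Data) : x.fst.size ≤ x.size := by
  cases x <;> simp [Data.size, Data.fst]; omega

theorem Data.size_snd_le (x : Data) : x.snd.size ≤ x.size := by
  cases x <;> simp [Data.size, Data.snd]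

theorem Data.size_toInt_le (x : Data) : x.toInt.natAbs.size ≤ x.size := by
  cases x <;> simp [Data.size, Data.toInt]

/-- A representation of the elements of a type by data; an element may have many names. -/
class HasRep (α : Type) where
  rep : Data → α → Prop

open HasRep

instance : HasRep Data := ⟨fun x a => x = a⟩

instance : HasRep Bool := ⟨fun x b => (x.toInt ≠ 0 ↔ b = true) ∧ x.size ≤ 2⟩

/-- Rationals are represented by fractions with positive denominator, not necessarily reduced. -/
instance : HasRep ℚ :=
  ⟨fun x q => ∃ a b : ℤ, x = Data.pair (Data.int a) (Data.int b) ∧ 0 < b ∧ q = a / b⟩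

instance : HasRep (WithTop ℚ) := ⟨fun x q => x.IsPrice q⟩

instance {α β : Type} [HasRep α] [HasRep β] : HasRep (α × β) :=
  ⟨fun x p => ∃ y z, x = Data.pair y z ∧ rep y p.1 ∧ rep z p.2⟩

/-- Lists are represented entrywise. -/
def Data.RepList {α : Type} [HasRep α] : Data → List α → Prop
  | x, [] => x = Data.int 0
  | x, a :: l => ∃ y z, x = Data.pair y z ∧ rep y a ∧ Data.RepList z l

instance {α : Type} [HasRep α] : HasRep (List α) := ⟨Data.RepList⟩

/-- A function which one program computes on all names in polynomial time. -/
def PolyTime {α β : Type} [HasRep α] [HasRep β] (f : α → β) : Prop :=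
  ∃ (g : Prog) (P : Polynomial ℕ), ∀ x a, rep x a →
    ∃ y t, g.Run x y t ∧ t + y.size ≤ P.eval x.size ∧ rep y (f a)

namespace PolyTime

variable {α β γ δ σ : Type} [HasRep α] [HasRep β] [HasRep γ]
  [HasRep δ] [HasRep σ]

theorem comp {f : β → γ} {g : α → β} (hf : PolyTime f) (hg : PolyTime g) :
    PolyTime fun a => f (g a) := by
  obtain ⟨F, P, hF⟩ := hf
  obtain ⟨G, Q, hG⟩ := hg
  refine ⟨Prog.comp F G, P.comp Q + Q + 1, fun x a hx => ?_⟩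
  obtain ⟨y, t, h1, h2, h3⟩ := hG x a hx
  obtain ⟨z, u, h4, h5, h6⟩ := hF y _ h3
  refine ⟨z, _, Prog.Run.comp h1 h4, ?_, h6⟩
  have : P.eval y.size ≤ P.eval (Q.eval x.size) := P.eval_nat_mono (by omega)
  simp only [Polynomial.eval_add, Polynomial.eval_comp, Polynomial.eval_one]
  omega

theorem pair {f : α → β} {g : α → γ} (hf : PolyTime f) (hg : PolyTime g) :
    PolyTime fun a => (f a, g a) := by
  obtain ⟨F, P, hF⟩ := hf
  obtain ⟨G, Q, hG⟩ := hg
  refine ⟨Prog.pair F G, P + Q + Polynomial.X + 2, fun x a hx => ?_⟩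
  obtain ⟨y, t, h1, h2, h3⟩ := hF x a hx
  obtain ⟨z, u, h4, h5, h6⟩ := hG x a hx
  refine ⟨_, _, Prog.Run.pair h1 h4, ?_, y, z, rfl, h3, h6⟩
  simp only [Polynomial.eval_add, Polynomial.eval_X, Polynomial.eval_ofNat, Data.size]
  omega

/-- A primitive instruction whose output is larger than its input by at most a constant. -/
theorem op {f : α → β} (o : Op) (k : ℕ) (hk : ∀ x, (o.apply x).size ≤ x.size + k)
    (h : ∀ x a, rep x a → rep (o.apply x) (f a)) : PolyTime f := by
  refine ⟨Prog.op o, 2 * Polynomial.X + Polynomial.C (k + 1), fun x a hx =>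
    ⟨_, _, Prog.Run.op o x, ?_, h x a hx⟩⟩
  have := hk x
  simp only [Polynomial.eval_add, Polynomial.eval_mul, Polynomial.eval_ofNat, Polynomial.eval_X,
    Polynomial.eval_C]
  omega

theorem id : PolyTime fun a : α => a :=
  op Op.id 0 (fun _ => le_rfl) fun _ _ h => h

theorem fst : PolyTime (Prod.fst : α × β → α) :=
  op Op.fst 0 Data.size_fst_le (by rintro x a ⟨y, z, rfl, h, -⟩; exact h)

theorem snd : PolyTime (Prod.snd : α × β → β) :=
  op Op.snd 0 Data.size_snd_le (by rintro x a ⟨y, z, rfl, -, h⟩; exact h)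

theorem congr {f g : α → β} (hf : PolyTime f) (h : ∀ a, f a = g a) : PolyTime g := by
  rwa [← funext h]

theorem nil : PolyTime fun _ : α => ([] : List β) :=
  op (Op.const 0) 1 (fun x => by simp [Op.apply, Data.size]) fun _ _ _ => rfl

theorem top : PolyTime fun _ : α => (⊤ : WithTop ℚ) :=
  op (Op.const 0) 1 (fun x => by simp [Op.apply, Data.size]) fun _ _ _ => Data.IsPrice.top

theorem coe_withTop {f : α → ℚ} (hf : PolyTime f) : PolyTime fun a => (f a : WithTop ℚ) := by
  refine comp (f := fun q : ℚ => (q : WithTop ℚ)) (op Op.id 0 (fun _ => le_rfl) ?_) hf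
  rintro x q ⟨a, b, rfl, hb, rfl⟩
  exact Data.IsPrice.finite a b hb

theorem headD_nil : PolyTime fun l : List (List α) => l.headD [] := by
  refine op Op.fst 0 Data.size_fst_le ?_
  rintro x (_ | ⟨a, l⟩) h
  · obtain rfl : x = Data.int 0 := h
    exact (rfl : Data.int 0 = Data.int 0)
  · obtain ⟨y, z, rfl, hy, -⟩ := h
    exact hy

theorem ite {c : α → Bool} {f g : α → β} (hc : PolyTime c) (hf : PolyTime f) (hg : PolyTime g) :
    PolyTime fun a => if c a = true then f a else g a := by
  obtain ⟨C, R, hC⟩ := hc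
  obtain ⟨F, P, hF⟩ := hf
  obtain ⟨G, Q, hG⟩ := hg
  refine ⟨Prog.ite C F G, R + P + Q + Polynomial.X + 1, fun x a hx => ?_⟩
  obtain ⟨b, s, h1, h2, h3, -⟩ := hC x a hx
  simp only [Polynomial.eval_add, Polynomial.eval_X, Polynomial.eval_one]
  by_cases hb : b.toInt = 0
  · obtain ⟨y, t, h4, h5, h6⟩ := hG x a hx
    have : ¬ c a = true := fun h => (h3.2 h) hb
    refine ⟨y, _, Prog.Run.ite_neg h1 hb h4, by omega, ?_⟩
    rwa [if_neg this]
  · obtain ⟨y, t, h4, h5, h6⟩ := hF x a hx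
    refine ⟨y, _, Prog.Run.ite_pos h1 hb h4, by omega, ?_⟩
    rwa [if_pos (h3.1 hb)]

/-! ### Arithmetic -/

theorem size_natAbs_add_le (a b : ℤ) :
    (a + b).natAbs.size ≤ max a.natAbs.size b.natAbs.size + 1 := by
  rw [Nat.size_le]
  have ha := Nat.lt_size_self a.natAbs
  have hb := Nat.lt_size_self b.natAbs
  have h1 : 2 ^ a.natAbs.size ≤ 2 ^ max a.natAbs.size b.natAbs.size :=
    Nat.pow_le_pow_right (by norm_num) (le_max_left _ _)
  have h2 : 2 ^ b.natAbs.size ≤ 2 ^ max a.natAbs.size b.natAbs.size :=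
    Nat.pow_le_pow_right (by norm_num) (le_max_right _ _)
  have := Int.natAbs_add_le a b
  rw [pow_succ]
  omega

theorem size_natAbs_mul_le (a b : ℤ) :
    (a * b).natAbs.size ≤ a.natAbs.size + b.natAbs.size := by
  rw [Nat.size_le, Int.natAbs_mul, pow_add]
  exact Nat.mul_lt_mul'' (Nat.lt_size_self _) (Nat.lt_size_self _)

instance : HasRep ℤ := ⟨fun x z => x = Data.int z⟩

theorem intConst (z : ℤ) : PolyTime fun _ : α => z := by
  refine op (Op.const z) (1 + z.natAbs.size) (fun x => ?_) fun _ _ _ => rfl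
  simp [Op.apply, Data.size]

theorem intAdd {f g : α → ℤ} (hf : PolyTime f) (hg : PolyTime g) :
    PolyTime fun a => f a + g a := by
  refine comp (f := fun p : ℤ × ℤ => p.1 + p.2) (op Op.add 2 (fun x => ?_) ?_) (hf.pair hg)
  · have h1 := size_natAbs_add_le x.fst.toInt x.snd.toInt
    have h2 := x.fst.size_toInt_le
    have h3 := x.snd.size_toInt_le
    have h4 := x.size_fst_le
    have h5 := x.size_snd_le
    simp only [Op.apply, Data.size]
    omega
  · rintro x ⟨a, b⟩ ⟨y, z, rfl, rfl, rfl⟩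
    rfl

theorem intSub {f g : α → ℤ} (hf : PolyTime f) (hg : PolyTime g) :
    PolyTime fun a => f a - g a := by
  refine comp (f := fun p : ℤ × ℤ => p.1 - p.2) (op Op.sub 2 (fun x => ?_) ?_) (hf.pair hg)
  · have h1 := size_natAbs_add_le x.fst.toInt (-x.snd.toInt)
    have h2 := x.fst.size_toInt_le
    have h3 := x.snd.size_toInt_le
    have h4 := x.size_fst_le
    have h5 := x.size_snd_le
    rw [← sub_eq_add_neg, Int.natAbs_neg] at h1
    simp only [Op.apply, Data.size]
    omega
  · rintro x ⟨a, b⟩ ⟨y, z, rfl, rfl, rfl⟩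
    rfl

theorem intMul {f g : α → ℤ} (hf : PolyTime f) (hg : PolyTime g) :
    PolyTime fun a => f a * g a := by
  refine comp (f := fun p : ℤ × ℤ => p.1 * p.2) (op Op.mul 1 (fun x => ?_) ?_) (hf.pair hg)
  · have h1 := size_natAbs_mul_le x.fst.toInt x.snd.toInt
    have h2 := x.fst.size_toInt_le
    have h3 := x.snd.size_toInt_le
    have h4 : x.fst.size + x.snd.size ≤ x.size + 2 ∨ x.fst.toInt = 0 := by
      cases x <;> simp [Data.fst, Data.snd, Data.size, Data.toInt]; omega
    simp only [Op.apply, Data.size]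
    rcases h4 with h4 | h4
    · rcases x with z | ⟨a, b⟩
      · simp [Data.fst, Data.snd, Data.toInt]
      · simp only [Data.fst, Data.snd, Data.size] at *
        omega
    · simp [h4]
  · rintro x ⟨a, b⟩ ⟨y, z, rfl, rfl, rfl⟩
    rfl

theorem intLe {f g : α → ℤ} (hf : PolyTime f) (hg : PolyTime g) :
    PolyTime fun a => decide (f a ≤ g a) := by
  refine comp (f := fun p : ℤ × ℤ => decide (p.1 ≤ p.2)) (op Op.le 1 (fun x => ?_) ?_)
    (hf.pair hg)
  · have := x.size_pos
    simp only [Op.apply]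
    split_ifs <;> simp only [Data.size, Int.natAbs_one, Int.natAbs_zero, Nat.size_one,
      Nat.size_zero] <;> omega
  · rintro x ⟨a, b⟩ ⟨y, z, rfl, rfl, rfl⟩
    simp only [Op.apply, Data.fst, Data.snd, Data.toInt]
    constructor
    · split_ifs with h <;> simp [h, Data.toInt]
    · change 1 + Nat.size (Int.natAbs (if a ≤ b then 1 else 0)) ≤ 2
      split_ifs <;> simp

/-- Computing with a numerator and a denominator. -/
theorem ratOfInt {f : α → ℚ} {a b : Data → ℤ} (ha : PolyTime a) (hb : PolyTime b)
    (h : ∀ x y, rep x y → 0 < b x ∧ f y = a x / b x) : PolyTime f := by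
  obtain ⟨g, P, hg⟩ := ha.pair hb
  refine ⟨g, P, fun x y hx => ?_⟩
  obtain ⟨z, t, h1, h2, u, v, rfl, rfl, rfl⟩ := hg x x rfl
  exact ⟨_, t, h1, h2, a x, b x, rfl, (h x y hx).1, (h x y hx).2⟩

theorem toInt {f : α → Data} (hf : PolyTime f) : PolyTime fun a => (f a).toInt := by
  have h : PolyTime fun x : Data => Data.pair x (Data.int 0) := by
    have := (id (α := Data)).pair (intConst (α := Data) 0)
    obtain ⟨g, P, hg⟩ := this
    refine ⟨g, P, fun x a hx => ?_⟩
    obtain ⟨z, t, h1, h2, u, v, rfl, rfl, rfl⟩ := hg x a hx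
    exact ⟨_, t, h1, h2, rfl⟩
  have h' : PolyTime fun x : Data => x.fst.toInt + x.snd.toInt := by
    refine op Op.add 2 (fun x => ?_) ?_
    · have h1 := size_natAbs_add_le x.fst.toInt x.snd.toInt
      have h2 := x.fst.size_toInt_le
      have h3 := x.snd.size_toInt_le
      have h4 := x.size_fst_le
      have h5 := x.size_snd_le
      simp only [Op.apply, Data.size]
      omega
    · rintro x a rfl
      rfl
  refine ((h'.comp h).comp hf).congr fun a => ?_
  simp [Data.fst, Data.snd, Data.toInt]

theorem dataFst {f : α → Data} (hf : PolyTime f) : PolyTime fun a => (f a).fst :=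
  comp (f := Data.fst) (op Op.fst 0 Data.size_fst_le (by rintro x a rfl; rfl)) hf

theorem dataSnd {f : α → Data} (hf : PolyTime f) : PolyTime fun a => (f a).snd :=
  comp (f := Data.snd) (op Op.snd 0 Data.size_snd_le (by rintro x a rfl; rfl)) hf

theorem dataNum : PolyTime fun x : Data => x.fst.fst.toInt := toInt (dataFst (dataFst id))
theorem dataDen : PolyTime fun x : Data => x.fst.snd.toInt := toInt (dataSnd (dataFst id))
theorem dataNum' : PolyTime fun x : Data => x.snd.fst.toInt := toInt (dataFst (dataSnd id))
theorem dataDen' : PolyTime fun x : Data => x.snd.snd.toInt := toInt (dataSnd (dataSnd id))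

theorem zero : PolyTime fun _ : α => (0 : ℚ) := by
  refine ratOfInt (intConst 0) (intConst 1) fun x y _ => ?_
  simp

theorem add {f g : α → ℚ} (hf : PolyTime f) (hg : PolyTime g) :
    PolyTime fun a => f a + g a := by
  refine comp (f := fun p : ℚ × ℚ => p.1 + p.2) (ratOfInt
    (intAdd (intMul dataNum dataDen') (intMul dataNum' dataDen)) (intMul dataDen dataDen') ?_)
    (hf.pair hg)
  rintro x ⟨p, q⟩ ⟨y, z, rfl, ⟨a, b, rfl, hb, rfl⟩, ⟨c, d, rfl, hd, rfl⟩⟩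
  simp only [Data.fst, Data.snd, Data.toInt]
  refine ⟨by positivity, ?_⟩
  have : (b : ℚ) ≠ 0 := by exact_mod_cast hb.ne'
  have : (d : ℚ) ≠ 0 := by exact_mod_cast hd.ne'
  push_cast
  field_simp
  try ring

theorem mul {f g : α → ℚ} (hf : PolyTime f) (hg : PolyTime g) :
    PolyTime fun a => f a * g a := by
  refine comp (f := fun p : ℚ × ℚ => p.1 * p.2) (ratOfInt
    (intMul dataNum dataNum') (intMul dataDen dataDen') ?_) (hf.pair hg)
  rintro x ⟨p, q⟩ ⟨y, z, rfl, ⟨a, b, rfl, hb, rfl⟩, ⟨c, d, rfl, hd, rfl⟩⟩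
  simp only [Data.fst, Data.snd, Data.toInt]
  refine ⟨by positivity, ?_⟩
  push_cast
  rw [div_mul_div_comm]

theorem neg {f : α → ℚ} (hf : PolyTime f) : PolyTime fun a => - f a := by
  refine comp (f := fun p : ℚ => - p) (ratOfInt
    (intSub (intConst 0) (toInt (dataFst id))) (toInt (dataSnd id)) ?_) hf
  rintro x p ⟨a, b, rfl, hb, rfl⟩
  simp only [Data.fst, Data.snd, Data.toInt]
  refine ⟨by positivity, ?_⟩
  push_cast
  ring

theorem sub {f g : α → ℚ} (hf : PolyTime f) (hg : PolyTime g) :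
    PolyTime fun a => f a - g a :=
  (hf.add hg.neg).congr fun _ => (sub_eq_add_neg _ _).symm

theorem inv {f : α → ℚ} (hf : PolyTime f) : PolyTime fun a => (f a)⁻¹ := by
  refine comp (f := fun p : ℚ => p⁻¹) (ratOfInt
    (ite (intLe (toInt (dataFst id)) (intConst 0))
      (ite (intLe (intConst 0) (toInt (dataFst id))) (intConst 0)
        (intSub (intConst 0) (toInt (dataSnd id))))
      (toInt (dataSnd id)))
    (ite (intLe (toInt (dataFst id)) (intConst 0))
      (ite (intLe (intConst 0) (toInt (dataFst id))) (intConst 1)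
        (intSub (intConst 0) (toInt (dataFst id))))
      (toInt (dataFst id))) ?_) hf
  rintro x p ⟨a, b, rfl, hb, rfl⟩
  simp only [decide_eq_true_eq, inv_div]
  change (0 < if a ≤ 0 then if 0 ≤ a then (1 : ℤ) else 0 - a else a) ∧ (b / a : ℚ) =
    ((if a ≤ 0 then if 0 ≤ a then (0 : ℤ) else 0 - b else b : ℤ) : ℚ) /
      ((if a ≤ 0 then if 0 ≤ a then (1 : ℤ) else 0 - a else a : ℤ) : ℚ)
  rcases lt_trichotomy a 0 with h | rfl | h
  · rw [if_pos h.le, if_neg (by omega), if_pos h.le, if_neg (by omega)]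
    refine ⟨by omega, ?_⟩
    push_cast
    rw [zero_sub, zero_sub, neg_div_neg_eq]
  · simp
  · rw [if_neg (by omega), if_neg (by omega)]
    exact ⟨h, rfl⟩

theorem div {f g : α → ℚ} (hf : PolyTime f) (hg : PolyTime g) :
    PolyTime fun a => f a / g a :=
  (hf.mul hg.inv).congr fun _ => (div_eq_mul_inv _ _).symm

theorem le {f g : α → ℚ} (hf : PolyTime f) (hg : PolyTime g) :
    PolyTime fun a => decide (f a ≤ g a) := by
  have : PolyTime fun p : ℚ × ℚ => decide (p.1 ≤ p.2) := by
    obtain ⟨G, P, hG⟩ := intLe (intMul dataNum dataDen') (intMul dataNum' dataDen)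
    refine ⟨G, P, ?_⟩
    rintro x ⟨p, q⟩ ⟨y, z, rfl, ⟨a, b, rfl, hb, rfl⟩, ⟨c, d, rfl, hd, rfl⟩⟩
    obtain ⟨w, t, h1, h2, h3⟩ := hG _ _ rfl
    refine ⟨w, t, h1, h2, ?_⟩
    convert h3 using 2
    refine decide_eq_decide.2 ?_
    change (a / b : ℚ) ≤ c / d ↔ a * d ≤ c * b
    rw [div_le_div_iff₀ (by exact_mod_cast hb) (by exact_mod_cast hd)]
    exact_mod_cast Iff.rfl
  exact comp this (hf.pair hg)

theorem ite_le {f g : α → ℚ} {u v : α → β} (hf : PolyTime f) (hg : PolyTime g) (hu : PolyTime u)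
    (hv : PolyTime v) : PolyTime fun a => if f a ≤ g a then u a else v a :=
  (ite (hf.le hg) hu hv).congr fun a => by simp

theorem ratMax {f g : α → ℚ} (hf : PolyTime f) (hg : PolyTime g) :
    PolyTime fun a => max (f a) (g a) :=
  (ite_le hf hg hg hf).congr fun _ => (max_def _ _).symm

theorem ratMin {f g : α → ℚ} (hf : PolyTime f) (hg : PolyTime g) :
    PolyTime fun a => min (f a) (g a) :=
  (ite_le hf hg hf hg).congr fun _ => (min_def _ _).symm

/-! ### Recursion on lists -/

theorem length_le_size {x : Data} {l : List α} (h : rep x l) : l.length ≤ x.size := by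
  induction l generalizing x with
  | nil => exact Nat.zero_le _
  | cons a l ih =>
    obtain ⟨y, z, rfl, -, hz⟩ := h
    have := ih hz
    simp only [List.length_cons, Data.size]
    omega

/-- The test of a fold with state `(c, s, l)`: whether the list `l` is non-empty. -/
def foldTest : Prog :=
  Prog.comp (Prog.op Op.isPair) (Prog.comp (Prog.op Op.snd) (Prog.op Op.snd))

/-- One step of a fold: `(c, s, a :: l)` becomes `(c, g (c, s, a), l)`. -/
def foldBody (g : Prog) : Prog :=
  Prog.pair (Prog.op Op.fst)
    (Prog.pair
      (Prog.comp g (Prog.pair (Prog.op Op.fst)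
        (Prog.comp (Prog.pair (Prog.op Op.fst) (Prog.comp (Prog.op Op.fst) (Prog.op Op.snd)))
          (Prog.op Op.snd))))
      (Prog.comp (Prog.op Op.snd) (Prog.comp (Prog.op Op.snd) (Prog.op Op.snd))))

theorem foldTest_run (c s l : Data) : ∃ t, foldTest.Run (Data.pair c (Data.pair s l)) l.isPair t ∧
    t ≤ 3 * (Data.pair c (Data.pair s l)).size + 5 := by
  refine ⟨_, Prog.Run.comp (Prog.Run.comp (Prog.Run.op _ _) (Prog.Run.op _ _)) (Prog.Run.op _ _), ?_⟩
  simp only [Op.apply, Data.snd, Data.size]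
  omega

theorem foldBody_run {g : Prog} {c s a l y : Data} {t : ℕ}
    (h : g.Run (Data.pair c (Data.pair s a)) y t) :
    ∃ u, (foldBody g).Run (Data.pair c (Data.pair s (Data.pair a l)))
      (Data.pair c (Data.pair y l)) u ∧
      u ≤ t + 20 * (Data.pair c (Data.pair s (Data.pair a l))).size + 20 := by
  refine ⟨_, Prog.Run.pair (Prog.Run.op _ _) (Prog.Run.pair (Prog.Run.comp (Prog.Run.pair
    (Prog.Run.op _ _) (Prog.Run.comp (Prog.Run.op _ _) (Prog.Run.pair (Prog.Run.op _ _)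
      (Prog.Run.comp (Prog.Run.op _ _) (Prog.Run.op _ _))))) h)
    (Prog.Run.comp (Prog.Run.comp (Prog.Run.op _ _) (Prog.Run.op _ _)) (Prog.Run.op _ _))), ?_⟩
  simp only [Op.apply, Data.snd, Data.size]
  omega

/-- A step of a fold is admissible if it runs in polynomial time and adds to a measure `μ` of the
accumulator an amount which is polynomial in the size of the other arguments. -/
def FoldStep (μ : Data → ℕ) (step : γ → σ → α → σ) : Prop :=
  (∀ x, μ x ≤ x.size) ∧ (∀ x (s : σ), rep x s → x.size ≤ 2 * μ x + 3) ∧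
  ∃ (g : Prog) (P Q : Polynomial ℕ), ∀ x y z c s a, rep x c → rep y s → rep z a →
    ∃ w t, g.Run (Data.pair x (Data.pair y z)) w t ∧
      t ≤ P.eval (Data.pair x (Data.pair y z)).size ∧
      μ w ≤ μ y + Q.eval (x.size + z.size) ∧ rep w (step c s a)

theorem fold_run {μ : Data → ℕ} {step : γ → σ → α → σ} {g : Prog} {P Q : Polynomial ℕ}
    (hμ' : ∀ x (s : σ), rep x s → x.size ≤ 2 * μ x + 3)
    (hg : ∀ x y z c s a, rep x c → rep y s → rep z a →
      ∃ w t, g.Run (Data.pair x (Data.pair y z)) w t ∧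
        t ≤ P.eval (Data.pair x (Data.pair y z)).size ∧
        μ w ≤ μ y + Q.eval (x.size + z.size) ∧ rep w (step c s a))
    {x : Data} {c : γ} (hx : rep x c) (Z M : ℕ) (hxZ : x.size ≤ Z) :
    ∀ (l : List α) (y z : Data) (s : σ), rep y s → rep z l → z.size ≤ Z →
      μ y + l.length * Q.eval (2 * Z) ≤ M →
      ∃ w t, (Prog.loop foldTest (foldBody g)).Run (Data.pair x (Data.pair y z))
          (Data.pair x (Data.pair w (Data.int 0))) t ∧
        t ≤ (l.length + 1) * (P.eval (2 * Z + 2 * M + 5) + 24 * (2 * Z + 2 * M + 5) + 26) ∧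
        μ w ≤ M ∧ rep w (l.foldl (step c) s) := by
  intro l
  induction l with
  | nil =>
    intro y z s hy hz hzZ hM
    obtain rfl : z = Data.int 0 := hz
    obtain ⟨t, h1, h2⟩ := foldTest_run x y (Data.int 0)
    refine ⟨y, _, Prog.Run.loop_stop h1 rfl, ?_, by simpa using hM, hy⟩
    have := hμ' y s hy
    simp only [Data.size, List.length_nil] at *
    omega
  | cons a l ih =>
    intro y z s hy hz hzZ hM
    obtain ⟨za, zl, rfl, hza, hzl⟩ := hz
    obtain ⟨t, h1, h2⟩ := foldTest_run x y (Data.pair za zl)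
    obtain ⟨w, u, h3, h4, h5, h6⟩ := hg x y za c s a hx hy hza
    obtain ⟨v, h7, h8⟩ := foldBody_run (l := zl) h3
    have hsz := hμ' y s hy
    simp only [Data.size, List.length_cons] at h2 h4 h8 hzZ hM ⊢
    have hQ : Q.eval (x.size + za.size) ≤ Q.eval (2 * Z) := Q.eval_nat_mono (by omega)
    rw [Nat.add_mul, Nat.one_mul] at hM
    obtain ⟨w', t', h9, h10, h11, h12⟩ := ih w zl (step c s a) h6 hzl (by omega) (by omega)
    refine ⟨w', _, Prog.Run.loop_step h1 one_ne_zero h7 h9, ?_, h11, h12⟩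
    have hP : P.eval (1 + x.size + (1 + y.size + za.size)) ≤ P.eval (2 * Z + 2 * M + 5) :=
      P.eval_nat_mono (by omega)
    rw [Nat.add_mul _ 1, Nat.one_mul]
    simp only [Data.size]
    omega

theorem foldl_of_step {μ : Data → ℕ} {step : γ → σ → α → σ} (h : FoldStep μ step) :
    PolyTime fun p : γ × σ × List α => p.2.2.foldl (step p.1) p.2.1 := by
  obtain ⟨hμ, hμ', g, P, Q, hg⟩ := h
  let M : Polynomial ℕ := Polynomial.X + Polynomial.X * Q.comp (2 * Polynomial.X)
  let B : Polynomial ℕ := 2 * Polynomial.X + 2 * M + 5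
  refine ⟨Prog.comp (Prog.comp (Prog.op Op.fst) (Prog.op Op.snd))
    (Prog.loop foldTest (foldBody g)),
    (Polynomial.X + 1) * (P.comp B + 24 * B + 26) + 6 * B + 20, ?_⟩
  rintro d ⟨c, s, l⟩ ⟨x, d', rfl, hx, y, z, rfl, hy, hz⟩
  simp only at hx hy hz
  set Z := (Data.pair x (Data.pair y z)).size with hZ
  have hlen := length_le_size hz
  have hμy := hμ y
  have hZ' : Z = 1 + x.size + (1 + y.size + z.size) := rfl
  have hB : B.eval Z = 2 * Z + 2 * M.eval Z + 5 := by simp [B]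
  have hM : M.eval Z = Z + Z * Q.eval (2 * Z) := by simp [M]
  have hmul : l.length * Q.eval (2 * Z) ≤ Z * Q.eval (2 * Z) :=
    Nat.mul_le_mul_right _ (by omega)
  obtain ⟨w, t, h1, h2, h3, h4⟩ := fold_run hμ' hg hx Z (M.eval Z) (by omega) l y z s hy hz
    (by omega) (by omega)
  have hw := hμ' w _ h4
  rw [← hB] at h2
  have h5 : (l.length + 1) * (P.eval (B.eval Z) + 24 * B.eval Z + 26) ≤
      (Z + 1) * (P.eval (B.eval Z) + 24 * B.eval Z + 26) :=
    Nat.mul_le_mul_right _ (by omega)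
  refine ⟨w, _, Prog.Run.comp h1 (Prog.Run.comp (Prog.Run.op _ _) (Prog.Run.op _ _)), ?_, h4⟩
  simp only [Polynomial.eval_add, Polynomial.eval_mul, Polynomial.eval_comp, Polynomial.eval_X,
    Polynomial.eval_one, Polynomial.eval_ofNat, Op.apply, Data.snd, Data.size,
    Int.natAbs_zero, Nat.size_zero]
  omega

theorem foldl {μ : Data → ℕ} {step : γ → σ → α → σ} (h : FoldStep μ step) {c : δ → γ} {s : δ → σ}
    {l : δ → List α} (hc : PolyTime c) (hs : PolyTime s) (hl : PolyTime l) :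
    PolyTime fun x => (l x).foldl (step (c x)) (s x) :=
  (foldl_of_step h).comp (hc.pair (hs.pair hl))

theorem foldStep_cons {f : γ → α → β} (hf : PolyTime fun p : γ × α => f p.1 p.2) :
    FoldStep Data.size fun c (acc : List β) a => f c a :: acc := by
  obtain ⟨g, P, hg⟩ := hf
  refine ⟨fun _ => le_rfl, fun _ _ _ => by omega,
    Prog.pair (Prog.comp g (Prog.pair (Prog.op Op.fst)
      (Prog.comp (Prog.op Op.snd) (Prog.op Op.snd)))) (Prog.comp (Prog.op Op.fst) (Prog.op Op.snd)),
    P + 10 * Polynomial.X + 20, P.comp (Polynomial.X + 1) + 1, fun x y z c s a hx hy hz => ?_⟩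
  obtain ⟨w, t, h1, h2, h3⟩ := hg (Data.pair x z) (c, a) ⟨x, z, rfl, hx, hz⟩
  refine ⟨_, _, Prog.Run.pair (Prog.Run.comp (Prog.Run.pair (Prog.Run.op _ _)
    (Prog.Run.comp (Prog.Run.op _ _) (Prog.Run.op _ _))) h1)
    (Prog.Run.comp (Prog.Run.op _ _) (Prog.Run.op _ _)), ?_, ?_, w, y, rfl, h3, hy⟩
  · have : P.eval (Data.pair x z).size ≤ P.eval (Data.pair x (Data.pair y z)).size :=
      P.eval_nat_mono (by simp only [Data.size]; omega)
    simp only [Polynomial.eval_add, Polynomial.eval_mul, Polynomial.eval_X,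
      Polynomial.eval_ofNat, Op.apply, Data.snd, Data.size] at *
    omega
  · have : (Data.pair x z).size = x.size + z.size + 1 := by simp only [Data.size]; omega
    rw [this] at h2
    simp only [Polynomial.eval_add, Polynomial.eval_comp, Polynomial.eval_X,
      Polynomial.eval_one, Data.size, Op.apply, Data.fst, Data.snd]
    omega

theorem foldl_cons_eq {A B : Type} (f : A → B) (l : List A) (acc : List B) :
    l.foldl (fun acc a => f a :: acc) acc = (l.map f).reverse ++ acc := by
  induction l generalizing acc with
  | nil => rfl
  | cons a l ih => simp [ih]

theorem reverse {l : δ → List α} (hl : PolyTime l) : PolyTime fun x => (l x).reverse :=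
  (foldl (foldStep_cons (f := fun (_ : δ) (a : α) => a) snd) id nil hl).congr fun x => by
    rw [foldl_cons_eq]; simp

theorem map {l : δ → List α} {f : δ → α → β} (hl : PolyTime l)
    (hf : PolyTime fun p : δ × α => f p.1 p.2) : PolyTime fun x => (l x).map (f x) :=
  (reverse (foldl (foldStep_cons hf) id nil hl)).congr fun x => by
    rw [foldl_cons_eq]; simp

theorem foldStep_zip : FoldStep Data.size fun (_ : γ) (s : List β × List (α × β)) (a : α) =>
    match s.1 with
    | [] => s
    | b :: r => (r, (a, b) :: s.2) := by
  let acc : Prog := Prog.comp (Prog.op Op.fst) (Prog.op Op.snd)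
  let rem : Prog := Prog.comp (Prog.op Op.fst) acc
  refine ⟨fun _ => le_rfl, fun _ _ _ => by omega,
    Prog.ite (Prog.comp (Prog.op Op.isPair) rem)
      (Prog.pair (Prog.comp (Prog.op Op.snd) rem)
        (Prog.pair (Prog.pair (Prog.comp (Prog.op Op.snd) (Prog.op Op.snd))
          (Prog.comp (Prog.op Op.fst) rem)) (Prog.comp (Prog.op Op.snd) acc))) acc,
    40 * Polynomial.X + 40, Polynomial.X + 10, ?_⟩
  rintro x y z c ⟨l, s⟩ a hx ⟨yl, ys, rfl, hl, hs⟩ hz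
  simp only at hl hs
  cases l with
  | nil =>
    obtain rfl : yl = Data.int 0 := hl
    refine ⟨_, _, Prog.Run.ite_neg (Prog.Run.comp (Prog.Run.comp (Prog.Run.comp (Prog.Run.op _ _)
      (Prog.Run.op _ _)) (Prog.Run.op _ _)) (Prog.Run.op _ _)) rfl
      (Prog.Run.comp (Prog.Run.op _ _) (Prog.Run.op _ _)), ?_, ?_, Data.int 0, ys, rfl, rfl, hs⟩
    · simp only [Polynomial.eval_add, Polynomial.eval_mul, Polynomial.eval_X,
        Polynomial.eval_ofNat, Op.apply, Data.snd, Data.fst, Data.size]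
      omega
    · simp [Op.apply, Data.snd, Data.fst]
  | cons b r =>
    obtain ⟨yb, yr, rfl, hb, hr⟩ := hl
    refine ⟨_, _, Prog.Run.ite_pos (Prog.Run.comp (Prog.Run.comp (Prog.Run.comp (Prog.Run.op _ _)
      (Prog.Run.op _ _)) (Prog.Run.op _ _)) (Prog.Run.op _ _)) one_ne_zero
      (Prog.Run.pair (Prog.Run.comp (Prog.Run.comp (Prog.Run.comp (Prog.Run.op _ _)
      (Prog.Run.op _ _)) (Prog.Run.op _ _)) (Prog.Run.op _ _)) (Prog.Run.pair (Prog.Run.pair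
        (Prog.Run.comp (Prog.Run.op _ _) (Prog.Run.op _ _)) (Prog.Run.comp (Prog.Run.comp
        (Prog.Run.comp (Prog.Run.op _ _) (Prog.Run.op _ _)) (Prog.Run.op _ _)) (Prog.Run.op _ _)))
        (Prog.Run.comp (Prog.Run.comp (Prog.Run.op _ _) (Prog.Run.op _ _)) (Prog.Run.op _ _)))),
      ?_, ?_, yr, _, rfl, hr, _, ys, rfl, ⟨z, yb, rfl, hz, hb⟩, hs⟩
    · simp only [Polynomial.eval_add, Polynomial.eval_mul, Polynomial.eval_X,
        Polynomial.eval_ofNat, Op.apply, Data.snd, Data.fst, Data.size]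
      omega
    · simp only [Polynomial.eval_add, Polynomial.eval_X,
        Polynomial.eval_ofNat, Op.apply, Data.snd, Data.fst, Data.size]
      omega

theorem foldl_zip_eq {A B : Type} (l : List A) (r : List B) (acc : List (A × B)) :
    (l.foldl (fun (s : List B × List (A × B)) a =>
      match s.1 with
      | [] => s
      | b :: r => (r, (a, b) :: s.2)) (r, acc)).2 = (l.zip r).reverse ++ acc := by
  induction l generalizing r acc with
  | nil => rfl
  | cons a l ih =>
    cases r with
    | nil =>
      rw [List.foldl_cons, ih]
      simp
    | cons b r =>
      rw [List.foldl_cons, ih]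
      simp

theorem zip {l : δ → List α} {r : δ → List β} (hl : PolyTime l) (hr : PolyTime r) :
    PolyTime fun x => (l x).zip (r x) :=
  (reverse (snd.comp (foldl (foldStep_zip (γ := δ) (α := α) (β := β)) id
    (hr.pair nil) hl))).congr fun x => by
    rw [foldl_zip_eq]; simp

/-- The first best element, for the objective `f`, of a list with a default element in front. -/
def argmax {A : Type} (f : A → ℚ) (s : A) (l : List A) : A :=
  l.foldl (fun s a => if f s ≤ f a then a else s) s

theorem foldStep_argmax {f : γ → α → ℚ} (hf : PolyTime fun p : γ × α => f p.1 p.2) :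
    FoldStep Data.size fun c s a => if f c s ≤ f c a then a else s := by
  have h : PolyTime fun p : γ × α × α => decide (f p.1 p.2.1 ≤ f p.1 p.2.2) :=
    (hf.comp (fst.pair (fst.comp snd))).le (hf.comp (fst.pair (snd.comp snd)))
  obtain ⟨g, P, hg⟩ := h
  refine ⟨fun _ => le_rfl, fun _ _ _ => by omega,
    Prog.ite g (Prog.comp (Prog.op Op.snd) (Prog.op Op.snd))
      (Prog.comp (Prog.op Op.fst) (Prog.op Op.snd)), P + 10 * Polynomial.X + 10, Polynomial.X,
    fun x y z c s a hx hy hz => ?_⟩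
  obtain ⟨b, t, h1, h2, h3, -⟩ := hg _ (c, s, a) ⟨x, _, rfl, hx, y, z, rfl, hy, hz⟩
  simp only [decide_eq_true_eq] at h3
  by_cases hb : b.toInt = 0
  · refine ⟨_, _, Prog.Run.ite_neg h1 hb (Prog.Run.comp (Prog.Run.op _ _) (Prog.Run.op _ _)),
      ?_, ?_, ?_⟩
    · simp only [Polynomial.eval_add, Polynomial.eval_mul, Polynomial.eval_X,
        Polynomial.eval_ofNat, Op.apply, Data.snd, Data.size] at *
      omega
    · simp [Op.apply, Data.snd, Data.fst]
    · change rep _ (if f c s ≤ f c a then a else s)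
      rw [if_neg fun h => (h3.2 h) hb]
      exact hy
  · refine ⟨_, _, Prog.Run.ite_pos h1 hb (Prog.Run.comp (Prog.Run.op _ _) (Prog.Run.op _ _)),
      ?_, ?_, ?_⟩
    · simp only [Polynomial.eval_add, Polynomial.eval_mul, Polynomial.eval_X,
        Polynomial.eval_ofNat, Op.apply, Data.snd, Data.size] at *
      omega
    · simp only [Op.apply, Data.snd, Polynomial.eval_X]
      omega
    · change rep _ (if f c s ≤ f c a then a else s)
      rw [if_pos (h3.1 hb)]
      exact hz

theorem argmax_polyTime {f : δ → α → ℚ} {s : δ → α} {l : δ → List α}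
    (hf : PolyTime fun p : δ × α => f p.1 p.2) (hs : PolyTime s) (hl : PolyTime l) :
    PolyTime fun x => argmax (f x) (s x) (l x) :=
  foldl (foldStep_argmax hf) id hs hl

theorem ratAdd_run : ∃ (g : Prog) (P : Polynomial ℕ), ∀ x : Data, ∃ t,
    g.Run x (Data.pair
      (Data.int (x.fst.fst.toInt * x.snd.snd.toInt + x.snd.fst.toInt * x.fst.snd.toInt))
      (Data.int (x.fst.snd.toInt * x.snd.snd.toInt))) t ∧ t ≤ P.eval x.size := by
  obtain ⟨g, P, hg⟩ := (intAdd (intMul dataNum dataDen') (intMul dataNum' dataDen)).pair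
    (intMul dataDen dataDen')
  refine ⟨g, P, fun x => ?_⟩
  obtain ⟨y, t, h1, h2, a, b, rfl, rfl, rfl⟩ := hg x x rfl
  exact ⟨t, h1, by omega⟩

theorem foldStep_add : FoldStep
    (fun x => max x.fst.toInt.natAbs.size x.snd.toInt.natAbs.size)
    fun (_ : γ) (s a : ℚ) => s + a := by
  obtain ⟨g, P, hg⟩ := ratAdd_run
  refine ⟨fun x => ?_, ?_, Prog.comp g (Prog.op Op.snd), P + Polynomial.X + 2, Polynomial.X + 1, ?_⟩
  · have h2 := x.fst.size_toInt_le
    have h3 := x.snd.size_toInt_le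
    have h4 := x.size_fst_le
    have h5 := x.size_snd_le
    exact max_le (h2.trans h4) (h3.trans h5)
  · rintro x s ⟨a, b, rfl, -, -⟩
    simp only [Data.fst, Data.snd, Data.toInt, Data.size]
    omega
  · rintro x _ _ c _ _ hx ⟨n, d, rfl, hd, rfl⟩ ⟨n', d', rfl, hd', rfl⟩
    obtain ⟨t, h1, h2⟩ := hg (Data.pair (Data.pair (Data.int n) (Data.int d))
      (Data.pair (Data.int n') (Data.int d')))
    refine ⟨_, _, Prog.Run.comp (Prog.Run.op _ _) h1, ?_, ?_, _, _, rfl, ?_, ?_⟩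
    · have := P.eval_nat_mono (Data.size_snd_le (Data.pair x (Data.pair (Data.pair (Data.int n)
        (Data.int d)) (Data.pair (Data.int n') (Data.int d')))))
      simp only [Data.snd] at this
      simp only [Polynomial.eval_add, Polynomial.eval_X, Polynomial.eval_ofNat]
      omega
    · simp only [Polynomial.eval_add, Polynomial.eval_X, Polynomial.eval_one, Data.fst, Data.snd,
        Data.toInt, Data.size]
      have h3 := size_natAbs_add_le (n * d') (n' * d)
      have h4 := size_natAbs_mul_le n d'
      have h5 := size_natAbs_mul_le n' d
      have h6 := size_natAbs_mul_le d d'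
      omega
    · simp only [Data.fst, Data.snd, Data.toInt]
      positivity
    · simp only [Data.fst, Data.snd, Data.toInt]
      have : (d : ℚ) ≠ 0 := by exact_mod_cast hd.ne'
      have : (d' : ℚ) ≠ 0 := by exact_mod_cast hd'.ne'
      push_cast
      rw [div_add_div _ _ (by assumption) (by assumption), mul_comm (n' : ℚ)]

theorem sum {l : δ → List ℚ} (hl : PolyTime l) : PolyTime fun x => (l x).sum :=
  (foldl (foldStep_add (γ := δ)) id zero hl).congr fun x => by
    rw [List.sum_eq_foldl]

end PolyTime

open PolyTime (argmax)

section Argmax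

variable {A : Type} (f : A → ℚ)

theorem argmax_mem (s : A) (l : List A) : argmax f s l = s ∨ argmax f s l ∈ l := by
  induction l generalizing s with
  | nil => exact Or.inl rfl
  | cons a l ih =>
    have e : argmax f s (a :: l) = argmax f (if f s ≤ f a then a else s) l := rfl
    rw [e, List.mem_cons]
    split_ifs
    exacts [Or.inr (ih a), (ih s).imp_right Or.inr]

theorem le_argmax_default (s : A) (l : List A) : f s ≤ f (argmax f s l) := by
  induction l generalizing s with
  | nil => exact le_rfl
  | cons a l ih =>
    refine le_trans ?_ (ih (if f s ≤ f a then a else s))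
    split_ifs with h
    exacts [h, le_rfl]

theorem le_argmax (s : A) {l : List A} {a : A} (h : a ∈ l) : f a ≤ f (argmax f s l) := by
  induction l generalizing s with
  | nil => simp at h
  | cons b l ih =>
    rcases List.mem_cons.1 h with rfl | h
    · refine le_trans ?_ (le_argmax_default f (if f s ≤ f a then a else s) l)
      split_ifs with h
      exacts [le_rfl, (not_le.1 h).le]
    · exact ih _ h

attribute [irreducible] PolyTime.argmax

end Argmax

/-! ## The second day: surplus, welfare and reserve prices -/

namespace SecondDay

variable {m : ℕ} (w ρ : Fin m → ℚ)

/-- Expected utility of a buyer who is offered the second item at price `q`. -/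
def surplus (q : ℚ) : ℚ := ∑ j, ρ j * max (w j - q) 0

/-- Probability that the second item is sold at price `q`. -/
def demand (q : ℚ) : ℚ := ∑ j, if q ≤ w j then ρ j else 0

/-- Expected value of the second item to the buyer, counted only when it is sold at price `q`. -/
def welfare (q : ℚ) : ℚ := ∑ j, if q ≤ w j then ρ j * w j else 0

/-- The smallest non-negative price whose surplus is at most `u`. -/
def reserve (u : ℚ) : ℚ :=
  argmax (fun x => x) 0 (List.ofFn fun k => (welfare w ρ (w k) - u) / demand w ρ (w k))

variable {w ρ}

theorem surplus_eq (q : ℚ) : surplus w ρ q = welfare w ρ q - q * demand w ρ q := by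
  simp only [surplus, welfare, demand, Finset.mul_sum, ← Finset.sum_sub_distrib]
  refine Finset.sum_congr rfl fun j _ => ?_
  split_ifs with h
  · rw [max_eq_left (sub_nonneg.2 h)]
    ring
  · rw [max_eq_right (by linarith)]
    ring

variable (hρ : ∀ j, 0 < ρ j)
include hρ

theorem surplus_nonneg (q : ℚ) : 0 ≤ surplus w ρ q :=
  Finset.sum_nonneg fun j _ => mul_nonneg (hρ j).le (le_max_right _ _)

theorem surplus_antitone : Antitone (surplus w ρ) := fun a b h =>
  Finset.sum_le_sum fun j _ => mul_le_mul_of_nonneg_left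
    (max_le_max (by linarith) le_rfl) (hρ j).le

theorem demand_pos (k : Fin m) : 0 < demand w ρ (w k) := by
  refine Finset.sum_pos' (fun j _ => ?_) ⟨k, Finset.mem_univ _, ?_⟩
  · split_ifs
    exacts [(hρ j).le, le_rfl]
  · rw [if_pos le_rfl]
    exact hρ k

theorem welfare_antitone (hw : ∀ j, 0 ≤ w j) : Antitone (welfare w ρ) := fun a b h => by
  refine Finset.sum_le_sum fun j _ => ?_
  have := mul_nonneg (hρ j).le (hw j)
  split_ifs <;> linarith

theorem welfare_sub_le (q r : ℚ) : welfare w ρ r - q * demand w ρ r ≤ surplus w ρ q := by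
  simp only [surplus, welfare, demand, Finset.mul_sum, ← Finset.sum_sub_distrib]
  refine Finset.sum_le_sum fun j _ => ?_
  have h1 := mul_le_mul_of_nonneg_left (le_max_left (w j - q) 0) (hρ j).le
  have h2 := mul_nonneg (hρ j).le (le_max_right (w j - q) 0)
  split_ifs <;> linarith

omit hρ in
theorem surplus_eq_zero_or (q : ℚ) : surplus w ρ q = 0 ∨
    ∃ k, surplus w ρ q = welfare w ρ (w k) - q * demand w ρ (w k) := by
  by_cases h : (Finset.univ.filter fun j => q ≤ w j).Nonempty
  · obtain ⟨k, hk, hmin⟩ := Finset.exists_min_image _ w h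
    simp only [Finset.mem_filter, Finset.mem_univ, true_and] at hk hmin
    refine Or.inr ⟨k, ?_⟩
    have hiff : ∀ j, q ≤ w j ↔ w k ≤ w j := fun j => ⟨hmin j, hk.trans⟩
    simp only [surplus_eq, welfare, demand, hiff]
  · simp only [Finset.not_nonempty_iff_eq_empty, Finset.filter_eq_empty_iff, Finset.mem_univ,
      true_imp_iff] at h
    refine Or.inl (Finset.sum_eq_zero fun j _ => ?_)
    rw [max_eq_right (by linarith [not_le.1 (@h j)]), mul_zero]

omit hρ in
theorem reserve_nonneg (u : ℚ) : 0 ≤ reserve w ρ u := by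
  unfold reserve
  exact le_argmax_default (fun x : ℚ => x) 0 _

omit hρ in
theorem le_reserve (u : ℚ) (k : Fin m) :
    (welfare w ρ (w k) - u) / demand w ρ (w k) ≤ reserve w ρ u := by
  unfold reserve
  exact le_argmax (fun x : ℚ => x) 0 (List.mem_ofFn.2 ⟨k, rfl⟩)

omit hρ in
theorem reserve_eq_zero_or (u : ℚ) : reserve w ρ u = 0 ∨
    ∃ k, reserve w ρ u = (welfare w ρ (w k) - u) / demand w ρ (w k) := by
  unfold reserve
  refine (argmax_mem (fun x => x) 0 _).imp_right fun h => ?_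
  obtain ⟨k, hk⟩ := List.mem_ofFn.1 h
  exact ⟨k, hk.symm⟩

theorem surplus_reserve_le {u : ℚ} (hu : 0 ≤ u) : surplus w ρ (reserve w ρ u) ≤ u := by
  rcases surplus_eq_zero_or (w := w) (ρ := ρ) (reserve w ρ u) with h | ⟨k, h⟩
  · rwa [h]
  · have := le_reserve (w := w) (ρ := ρ) u k
    rw [div_le_iff₀ (demand_pos hρ k)] at this
    linarith

theorem surplus_reserve {u : ℚ} (hu : 0 ≤ u) (hu' : u ≤ surplus w ρ 0) :
    surplus w ρ (reserve w ρ u) = u := by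
  refine le_antisymm (surplus_reserve_le hρ hu) ?_
  rcases reserve_eq_zero_or (w := w) (ρ := ρ) u with h | ⟨k, hk⟩
  · rwa [h]
  · have := welfare_sub_le (w := w) hρ (reserve w ρ u) (w k)
    have h' : reserve w ρ u * demand w ρ (w k) = welfare w ρ (w k) - u := by
      rw [hk, div_mul_cancel₀ _ (demand_pos hρ k).ne']
    linarith

theorem reserve_le {u q : ℚ} (hq : 0 ≤ q) (h : surplus w ρ q ≤ u) : reserve w ρ u ≤ q := by
  rcases reserve_eq_zero_or (w := w) (ρ := ρ) u with h' | ⟨k, hk⟩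
  · rwa [h']
  · rw [hk, div_le_iff₀ (demand_pos hρ k)]
    have := welfare_sub_le (w := w) hρ q (w k)
    linarith

theorem welfare_le_welfare_reserve (hw : ∀ j, 0 ≤ w j) {u : ℚ} {k : Fin m}
    (h : surplus w ρ (w k) ≤ u) : welfare w ρ (w k) ≤ welfare w ρ (reserve w ρ u) :=
  welfare_antitone hρ hw (reserve_le hρ (hw k) h)

end SecondDay

/-! ## Mechanisms with two utility levels -/

namespace TwoLevel

open SecondDay

variable {n m : ℕ} (v π : Fin n → ℚ) (w ρ : Fin m → ℚ)

/-- Price of the first item for the `i`th type: a buyer of value `v` ends up with expected utility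
`v + c` if she gets the first item, and `d` otherwise. -/
def price₁ (c d : ℚ) (i : Fin n) : WithTop ℚ :=
  if d ≤ v i + c then ((surplus w ρ (reserve w ρ (max (v i + c) d)) - c : ℚ) : WithTop ℚ) else ⊤

/-- Price of the second item for the `i`th type. -/
def price₂ (c d : ℚ) (i : Fin n) : ℚ := reserve w ρ (max (v i + c) d)

/-- Expected revenue. -/
def objective (x : ℚ × ℚ) : ℚ :=
  ∑ i, π i * (welfare w ρ (reserve w ρ (max (v i + x.1) x.2)) -
    if x.2 ≤ v i + x.1 then x.1 else x.2)

/-- The levels for which all prices are non-negative and the utility levels are attained. -/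
def Feasible (x : ℚ × ℚ) : Prop := x.1 ≤ surplus w ρ 0 ∧ 0 ≤ x.2 ∧ x.2 ≤ surplus w ρ 0

/-- The best levels `d` for a given `c`, among finitely many candidates. -/
def bestGiven (c : ℚ) : ℚ × ℚ :=
  argmax (objective v π w ρ)
    (argmax (objective v π w ρ) (0, 0) (List.ofFn fun j => (c, surplus w ρ (w j))))
    (List.ofFn fun l => (c, max 0 (min (c + v l) (surplus w ρ 0))))

/-- The best levels among finitely many candidates. -/
def best : ℚ × ℚ :=
  argmax (objective v π w ρ) (0, 0) (List.ofFn fun l =>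
    argmax (objective v π w ρ) (0, 0) (List.ofFn fun j =>
      bestGiven v π w ρ (surplus w ρ (w j) - v l)))

variable {v π w ρ}

theorem argmax_feasible {f : ℚ × ℚ → ℚ} {s : ℚ × ℚ} {l : List (ℚ × ℚ)}
    (hs : Feasible w ρ s) (hl : ∀ x ∈ l, Feasible w ρ x) : Feasible w ρ (argmax f s l) := by
  rcases argmax_mem f s l with h | h
  · rwa [h]
  · exact hl _ h

section

variable (hρ : ∀ j, 0 < ρ j) (hv : ∀ i, 0 ≤ v i) (hw : ∀ j, 0 ≤ w j)
include hρ hv hw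

theorem best_feasible : Feasible w ρ (best v π w ρ) := by
  have h0 : Feasible w ρ (0, 0) :=
    ⟨surplus_nonneg hρ 0, le_rfl, surplus_nonneg hρ 0⟩
  refine argmax_feasible h0 (List.forall_mem_ofFn_iff.2 fun l => argmax_feasible h0
    (List.forall_mem_ofFn_iff.2 fun j => ?_))
  have hc : surplus w ρ (w j) - v l ≤ surplus w ρ 0 := by
    have := surplus_antitone (w := w) hρ (hw j)
    linarith [hv l]
  refine argmax_feasible (argmax_feasible h0 (List.forall_mem_ofFn_iff.2 fun k =>
    ⟨hc, surplus_nonneg hρ _, surplus_antitone hρ (hw k)⟩)) (List.forall_mem_ofFn_iff.2 fun k =>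
    ⟨hc, le_max_left _ _, max_le (surplus_nonneg hρ 0) (min_le_right _ _)⟩)

omit hρ hv hw in
theorem objective_bestGiven_le (l : Fin n) (j : Fin m) :
    objective v π w ρ (bestGiven v π w ρ (surplus w ρ (w j) - v l)) ≤
      objective v π w ρ (best v π w ρ) := by
  unfold best
  exact (le_argmax (objective v π w ρ) (0, 0) (l := List.ofFn fun j =>
    bestGiven v π w ρ (surplus w ρ (w j) - v l)) (List.mem_ofFn.2 ⟨j, rfl⟩)).trans
    (le_argmax (objective v π w ρ) (0, 0) (List.mem_ofFn.2 ⟨l, rfl⟩))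

omit hρ hv hw in
theorem objective_le_best {c d : ℚ} (hd : 0 ≤ d) (hd' : d ≤ surplus w ρ 0)
    (h1 : ∃ j l, c = surplus w ρ (w j) - v l)
    (h2 : (∃ j, d = surplus w ρ (w j)) ∨ ∃ l, d = c + v l) :
    objective v π w ρ (c, d) ≤ objective v π w ρ (best v π w ρ) := by
  obtain ⟨j, l, rfl⟩ := h1
  refine le_trans ?_ (objective_bestGiven_le l j)
  unfold bestGiven
  rcases h2 with ⟨k, rfl⟩ | ⟨k, rfl⟩
  · refine le_trans ?_ (le_argmax_default _ _ _)
    exact le_argmax (objective v π w ρ) (0, 0) (List.mem_ofFn.2 ⟨k, rfl⟩)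
  · refine le_argmax (objective v π w ρ) _ (List.mem_ofFn.2 ⟨k, ?_⟩)
    rw [min_eq_left hd', max_eq_right hd]

omit hv in
/-- Levels `c`, `d` can be lowered to candidate levels, keeping the set `S` of the types which get
the first item. -/
theorem exists_candidate {S : Finset (Fin n)} (hS : S.Nonempty) {k : Fin n → Fin m} {c d : ℝ}
    (h1 : ∀ i ∈ S, d ≤ v i + c) (h2 : ∀ i ∉ S, v i + c ≤ d)
    (h3 : ∀ i ∈ S, (surplus w ρ (w (k i)) : ℝ) ≤ v i + c)
    (h4 : ∀ i ∉ S, (surplus w ρ (w (k i)) : ℝ) ≤ d) :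
    ∃ c' d' : ℚ, 0 ≤ d' ∧ d' ≤ surplus w ρ 0 ∧ (∃ j l, c' = surplus w ρ (w j) - v l) ∧
      ((∃ j, d' = surplus w ρ (w j)) ∨ ∃ l, d' = c' + v l) ∧ (c' : ℝ) ≤ c ∧
      (∀ i ∈ S, d' ≤ v i + c' ∧ surplus w ρ (w (k i)) ≤ v i + c') ∧
      ∀ i ∉ S, v i + c' ≤ d' ∧ surplus w ρ (w (k i)) ≤ d' ∧ (d' : ℝ) ≤ d := by
  obtain ⟨i₁, hi₁, hmax₁⟩ := S.exists_max_image (fun i => surplus w ρ (w (k i)) - v i) hS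
  obtain ⟨b, hb, hmin⟩ := S.exists_min_image v hS
  have hU : ∀ j, 0 ≤ surplus w ρ (w j) := fun j => surplus_nonneg hρ _
  have hU' : ∀ j, surplus w ρ (w j) ≤ surplus w ρ 0 := fun j => surplus_antitone hρ (hw j)
  have hc : ((surplus w ρ (w (k i₁)) - v i₁ : ℚ) : ℝ) ≤ c := by
    push_cast
    linarith [h3 i₁ hi₁]
  by_cases hc' : Sᶜ.Nonempty
  · obtain ⟨a, ha, hmax⟩ := Sᶜ.exists_max_image v hc'
    obtain ⟨i₂, hi₂, hmax₂⟩ := Sᶜ.exists_max_image (fun i => surplus w ρ (w (k i))) hc'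
    simp only [Finset.mem_compl] at ha hmax hi₂ hmax₂
    have hab : v a ≤ v b := by
      have : (v a : ℝ) ≤ v b := by linarith [h1 b hb, h2 a ha]
      exact_mod_cast this
    have hd : ((surplus w ρ (w (k i₂)) : ℚ) : ℝ) ≤ d := h4 i₂ hi₂
    by_cases hB : surplus w ρ (w (k i₁)) - v i₁ < surplus w ρ (w (k i₂)) - v b
    · refine ⟨surplus w ρ (w (k i₂)) - v b, surplus w ρ (w (k i₂)), hU _, hU' _, ⟨_, _, rfl⟩,
        Or.inl ⟨_, rfl⟩, ?_, fun i hi => ⟨?_, ?_⟩, fun i hi => ⟨?_, hmax₂ i hi, hd⟩⟩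
      · push_cast
        linarith [h1 b hb]
      · linarith [hmin i hi]
      · linarith [hmax₁ i hi]
      · linarith [hmax i hi]
    push Not at hB
    by_cases hC : surplus w ρ (w (k i₂)) < surplus w ρ (w (k i₁)) - v i₁ + v a
    · refine ⟨surplus w ρ (w (k i₁)) - v i₁, surplus w ρ (w (k i₁)) - v i₁ + v a, ?_, ?_,
        ⟨_, _, rfl⟩, Or.inr ⟨_, rfl⟩, hc, fun i hi => ⟨?_, ?_⟩, fun i hi => ⟨?_, ?_, ?_⟩⟩
      · linarith [hU (k i₂)]
      · linarith [hU' (k i₁), hmin i₁ hi₁]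
      · linarith [hmin i hi]
      · linarith [hmax₁ i hi]
      · linarith [hmax i hi]
      · linarith [hmax₂ i hi]
      · push_cast at hc ⊢
        linarith [h2 a ha]
    push Not at hC
    refine ⟨surplus w ρ (w (k i₁)) - v i₁, surplus w ρ (w (k i₂)), hU _, hU' _, ⟨_, _, rfl⟩,
        Or.inl ⟨_, rfl⟩, hc, fun i hi => ⟨?_, ?_⟩, fun i hi => ⟨?_, hmax₂ i hi, hd⟩⟩
    · linarith [hmin i hi]
    · linarith [hmax₁ i hi]
    · linarith [hmax i hi]
  · have hall : ∀ i, i ∈ S := fun i => by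
      by_contra hi
      exact hc' ⟨i, Finset.mem_compl.2 hi⟩
    refine ⟨surplus w ρ (w (k i₁)) - v i₁, surplus w ρ (w (k i₁)) - v i₁ + v b, ?_, ?_,
      ⟨_, _, rfl⟩, Or.inr ⟨_, rfl⟩, hc, fun i hi => ⟨?_, ?_⟩, fun i hi => (hi (hall i)).elim⟩
    · linarith [hmax₁ b hb, hU (k b)]
    · linarith [hU' (k i₁), hmin i₁ hi₁]
    · linarith [hmin i hi]
    · linarith [hmax₁ i hi]

theorem sum_le_objective_best (hπ : ∀ i, 0 ≤ π i) {S : Finset (Fin n)} (hS : S.Nonempty)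
    {k : Fin n → Fin m} {c d : ℝ} {r : Fin n → ℝ}
    (h1 : ∀ i ∈ S, d ≤ v i + c) (h2 : ∀ i ∉ S, v i + c ≤ d)
    (h3 : ∀ i ∈ S, (surplus w ρ (w (k i)) : ℝ) ≤ v i + c)
    (h4 : ∀ i ∉ S, (surplus w ρ (w (k i)) : ℝ) ≤ d)
    (h5 : ∀ i ∈ S, r i ≤ welfare w ρ (w (k i)) - c)
    (h6 : ∀ i ∉ S, r i ≤ welfare w ρ (w (k i)) - d) :
    ∑ i, (π i : ℝ) * r i ≤ (objective v π w ρ (best v π w ρ) : ℝ) := by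
  obtain ⟨c', d', hd0, hd1, hc, hd, hc'c, hin, hout⟩ :=
    exists_candidate hρ hw hS h1 h2 h3 h4
  refine le_trans ?_ (Rat.cast_le.2 (objective_le_best hd0 hd1 hc hd))
  rw [objective, Rat.cast_sum]
  refine Finset.sum_le_sum fun i _ => ?_
  rw [Rat.cast_mul, Rat.cast_sub]
  refine mul_le_mul_of_nonneg_left ?_ (Rat.cast_nonneg.2 (hπ i))
  by_cases hi : i ∈ S
  · obtain ⟨ha, hb⟩ := hin i hi
    have : (welfare w ρ (w (k i)) : ℝ) ≤ welfare w ρ (reserve w ρ (max (v i + c') d')) :=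
      Rat.cast_le.2 (welfare_le_welfare_reserve hρ hw (hb.trans (le_max_left _ _)))
    rw [if_pos ha]
    linarith [h5 i hi]
  · obtain ⟨ha, hb, hd'd⟩ := hout i hi
    have : (welfare w ρ (w (k i)) : ℝ) ≤ welfare w ρ (reserve w ρ (max (v i + c') d')) :=
      Rat.cast_le.2 (welfare_le_welfare_reserve hρ hw (hb.trans (le_max_right _ _)))
    have h7 : ((if d' ≤ v i + c' then c' else d' : ℚ) : ℝ) ≤ d' := by
      rw [Rat.cast_le]
      split_ifs
      · linarith [hv i]
      · exact le_rfl
    linarith [h6 i hi]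

end

end TwoLevel

namespace TwoDayAuction

open SecondDay TwoLevel

variable {I : TwoDayAuction}

theorem sum_prob₁ (hI : I.Valid) : ∑ i, I.prob₁ i = 1 := hI.prob_sum

theorem sum_prob₂ (hI : I.Valid) : ∑ j, I.prob₂ j = 1 := by
  rw [← hI.prob_sum, Finset.sum_comm]
  rfl

theorem prob_div_prob₁ (hI : I.Valid) (hind : I.IndependentDays) (i : Fin I.n) (j : Fin I.m) :
    I.prob i j / I.prob₁ i = I.prob₂ j := by
  rw [hind i j, mul_div_cancel_left₀ _ (hI.prob₁_pos i).ne']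

namespace Mechanism

variable (M : Mechanism I)

/-- Expected second-day utility from the report `i` on the first day, when the second-day report
is truthful. -/
noncomputable def truthfulUtility₂ (i : Fin I.n) : ℝ :=
  ∑ j, (I.prob₂ j : ℝ) * M.utility₂ (I.v₂ j) i j

theorem expectedUtility_eq (hI : I.Valid) (hind : I.IndependentDays) (i i' : Fin I.n)
    (σ : Fin I.m → Fin I.m) : M.expectedUtility i i' σ =
      M.utility₁ (I.v₁ i) i' + ∑ j, (I.prob₂ j : ℝ) * M.utility₂ (I.v₂ j) i' (σ j) := by
  simp only [expectedUtility, prob_div_prob₁ hI hind]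

/-- Expected revenue from a truthful buyer of type `i`. -/
noncomputable def typeRevenue (i : Fin I.n) : ℝ :=
  (if M.x₁ i then M.p₁ i else 0) + ∑ j, (I.prob₂ j : ℝ) * if M.x₂ i j then M.p₂ i j else 0

theorem revenue_eq (hI : I.Valid) (hind : I.IndependentDays) :
    M.revenue = ∑ i, (I.prob₁ i : ℝ) * M.typeRevenue i := by
  refine Finset.sum_congr rfl fun i _ => ?_
  have h : ∑ j, (I.prob₂ j : ℝ) = 1 := by exact_mod_cast sum_prob₂ hI
  simp only [typeRevenue]
  rw [mul_add, Finset.mul_sum]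
  simp only [hind i, Rat.cast_mul, mul_add, Finset.sum_add_distrib]
  congr 1
  · rw [← Finset.sum_mul, ← Finset.mul_sum, h, mul_one]
  · exact Finset.sum_congr rfl fun j _ => by ring

section

variable {M}
variable (hI : I.Valid) (hind : I.IndependentDays) (hIC : M.IncentiveCompatible) (hIR : M.ExPostIR)
include hI hind hIC

theorem utility₁_add_le (i i' : Fin I.n) :
    M.utility₁ (I.v₁ i) i' + M.truthfulUtility₂ i' ≤
      M.utility₁ (I.v₁ i) i + M.truthfulUtility₂ i := by
  have := hIC i i' fun j => j
  rwa [M.expectedUtility_eq hI hind, M.expectedUtility_eq hI hind] at this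

theorem utility₂_le (i : Fin I.n) (j j' : Fin I.m) :
    M.utility₂ (I.v₂ j) i j' ≤ M.utility₂ (I.v₂ j) i j := by
  have := hIC i i (Function.update id j j')
  rw [M.expectedUtility_eq hI hind, M.expectedUtility_eq hI hind, add_le_add_iff_left,
    ← sub_nonneg, ← Finset.sum_sub_distrib, Finset.sum_eq_single j] at this
  · rw [Function.update_self, ← mul_sub] at this
    have hρ : (0 : ℝ) < I.prob₂ j := Rat.cast_pos.2 (hI.prob₂_pos j)
    exact sub_nonneg.1 (nonneg_of_mul_nonneg_right this hρ)
  · intro b _ hb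
    rw [Function.update_of_ne hb]
    simp
  · simp

include hIR

omit hI hind hIC in
theorem utility₂_nonneg (i : Fin I.n) (j : Fin I.m) : 0 ≤ M.utility₂ (I.v₂ j) i j := by
  unfold utility₂
  split_ifs with h
  · exact sub_nonneg.2 (hIR.2 i j h)
  · exact le_rfl

/-- After each report on the first day, the second day is at most as good as a posted price equal
to one of the valuations. -/
theorem exists_postedPrice (i : Fin I.n) : ∃ k,
    (surplus I.v₂ I.prob₂ (I.v₂ k) : ℝ) ≤ M.truthfulUtility₂ i ∧
    ∑ j, (I.prob₂ j : ℝ) * (if M.x₂ i j then M.p₂ i j else 0) ≤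
      welfare I.v₂ I.prob₂ (I.v₂ k) - M.truthfulUtility₂ i := by
  have hρ : ∀ j, (0 : ℝ) ≤ I.prob₂ j := fun j => Rat.cast_nonneg.2 (hI.prob₂_pos j).le
  have hw : ∀ j, (0 : ℝ) ≤ I.v₂ j := fun j => Rat.cast_nonneg.2 (hI.v₂_nonneg j)
  suffices h : ∃ k, (∀ j, max ((I.v₂ j : ℝ) - I.v₂ k) 0 ≤ M.utility₂ (I.v₂ j) i j) ∧
      ∀ j, M.x₂ i j = true → I.v₂ k ≤ I.v₂ j by
    obtain ⟨k, h1, h2⟩ := h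
    refine ⟨k, ?_, ?_⟩
    · simp only [surplus, truthfulUtility₂]
      push_cast
      exact Finset.sum_le_sum fun j _ => mul_le_mul_of_nonneg_left (h1 j) (hρ j)
    · rw [le_sub_iff_add_le, truthfulUtility₂, ← Finset.sum_add_distrib, welfare, Rat.cast_sum]
      refine Finset.sum_le_sum fun j _ => ?_
      unfold utility₂
      have := mul_nonneg (hρ j) (hw j)
      by_cases hj : M.x₂ i j = true
      · rw [if_pos hj, if_pos hj, if_pos (h2 j hj)]
        push_cast
        linarith
      · rw [if_neg hj, if_neg hj]
        split_ifs
        · push_cast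
          linarith
        · simp
  by_cases hA : (Finset.univ.filter fun j => M.x₂ i j = true).Nonempty
  · obtain ⟨k, hk, hmin⟩ := Finset.exists_min_image _ I.v₂ hA
    simp only [Finset.mem_filter, Finset.mem_univ, true_and] at hk hmin
    refine ⟨k, fun j => max_le ?_ (utility₂_nonneg hIR i j), hmin⟩
    refine le_trans ?_ (utility₂_le hI hind hIC i j k)
    rw [utility₂, if_pos hk]
    linarith [hIR.2 i k hk]
  · simp only [Finset.not_nonempty_iff_eq_empty, Finset.filter_eq_empty_iff, Finset.mem_univ,
      true_imp_iff] at hA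
    have hm : (Finset.univ : Finset (Fin I.m)).Nonempty := by
      by_contra h
      have := sum_prob₂ hI
      rw [Finset.not_nonempty_iff_eq_empty.1 h] at this
      simp at this
    obtain ⟨k, -, hmax⟩ := Finset.exists_max_image _ I.v₂ hm
    refine ⟨k, fun j => ?_, fun j hj => (hA hj).elim⟩
    have : (I.v₂ j : ℝ) ≤ I.v₂ k := Rat.cast_le.2 (hmax j (Finset.mem_univ _))
    rw [max_eq_right (by linarith)]
    exact utility₂_nonneg hIR i j

theorem revenue_le_objective_best :
    M.revenue ≤ (objective I.v₁ I.prob₁ I.v₂ I.prob₂ (best I.v₁ I.prob₁ I.v₂ I.prob₂) : ℝ) := by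
  classical
  choose k hk hk' using exists_postedPrice hI hind hIC hIR
  rw [revenue_eq _ hI hind]
  set U := M.truthfulUtility₂ with hU
  have hv : ∀ i, (0 : ℝ) ≤ I.v₁ i := fun i => Rat.cast_nonneg.2 (hI.v₁_nonneg i)
  have h := utility₁_add_le hI hind hIC
  have hr : ∀ i, M.x₁ i = true →
      M.typeRevenue i ≤ welfare I.v₂ I.prob₂ (I.v₂ (k i)) - (U i - M.p₁ i) := fun i hi => by
    have := hk' i
    rw [typeRevenue, if_pos hi]
    linarith
  have hr' : ∀ i, ¬ M.x₁ i = true →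
      M.typeRevenue i ≤ welfare I.v₂ I.prob₂ (I.v₂ (k i)) - U i := fun i hi => by
    have := hk' i
    rw [typeRevenue, if_neg hi]
    linarith
  have key := @sum_le_objective_best I.n I.m I.v₁ I.prob₁ I.v₂ I.prob₂ hI.prob₂_pos hI.v₁_nonneg
    hI.v₂_nonneg fun i => (hI.prob₁_pos i).le
  by_cases hA : ∃ i, M.x₁ i = true
  · obtain ⟨a, ha⟩ := hA
    have hc : ∀ i, M.x₁ i = true → U i - M.p₁ i = U a - M.p₁ a := fun i hi => by
      have h1 := h i a
      have h2 := h a i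
      simp only [utility₁, if_pos hi, if_pos ha] at h1 h2
      linarith
    have hin : ∀ i ∈ Finset.univ.filter fun i => M.x₁ i = true, U i ≤ I.v₁ i + (U a - M.p₁ a) :=
      fun i hi => by
        simp only [Finset.mem_filter, Finset.mem_univ, true_and] at hi
        linarith [hc i hi, hIR.1 i hi]
    by_cases hB : ∃ i, ¬ M.x₁ i = true
    · obtain ⟨b, hb⟩ := hB
      have hd : ∀ i, ¬ M.x₁ i = true → U i = U b := fun i hi => by
        have h1 := h i b
        have h2 := h b i
        simp only [utility₁, if_neg hi, if_neg hb] at h1 h2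
        linarith
      refine key (S := Finset.univ.filter fun i => M.x₁ i = true) ⟨a, by simpa using ha⟩
        (c := U a - M.p₁ a) (d := U b) (k := k) (fun i hi => ?_) (fun i hi => ?_)
        (fun i hi => (hk i).trans (hin i hi)) (fun i hi => ?_) (fun i hi => ?_) (fun i hi => ?_) <;>
        simp only [Finset.mem_filter, Finset.mem_univ, true_and] at hi
      · have := h i b
        simp only [utility₁, if_pos hi, if_neg hb] at this
        linarith [hc i hi]
      · have := h i a
        simp only [utility₁, if_neg hi, if_pos ha] at this
        linarith [hd i hi]
      · linarith [hk i, hd i hi]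
      · linarith [hr i hi, hc i hi]
      · linarith [hr' i hi, hd i hi]
    · push Not at hB
      refine key (S := Finset.univ) ⟨a, Finset.mem_univ a⟩
        (c := U a - M.p₁ a) (d := U a - M.p₁ a) (k := k) (fun i hi => ?_) (fun i hi => ?_)
        (fun i _ => (hk i).trans (hin i (by simpa using hB i))) (fun i hi => ?_) (fun i hi => ?_)
        (fun i hi => ?_)
      · linarith [hv i]
      · exact (hi (Finset.mem_univ i)).elim
      · exact (hi (Finset.mem_univ i)).elim
      · linarith [hr i (hB i), hc i (hB i)]
      · exact (hi (Finset.mem_univ i)).elim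
  · push Not at hA
    have hn : (Finset.univ : Finset (Fin I.n)).Nonempty := by
      by_contra h
      have := sum_prob₁ hI
      rw [Finset.not_nonempty_iff_eq_empty.1 h] at this
      simp at this
    obtain ⟨b, -, hmax⟩ := Finset.exists_max_image _ I.v₁ hn
    have hd : ∀ i, U i = U b := fun i => by
      have h1 := h i b
      have h2 := h b i
      simp only [utility₁, if_neg (hA _)] at h1 h2
      linarith
    refine key (S := {b}) ⟨b, Finset.mem_singleton_self b⟩
      (c := U b - I.v₁ b) (d := U b) (k := k) (fun i hi => ?_) (fun i _ => ?_)
      (fun i hi => ?_) (fun i _ => ?_) (fun i hi => ?_) (fun i _ => ?_)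
    · rw [Finset.mem_singleton.1 hi]
      linarith
    · have : (I.v₁ i : ℝ) ≤ I.v₁ b := Rat.cast_le.2 (hmax i (Finset.mem_univ _))
      linarith
    · rw [Finset.mem_singleton.1 hi]
      linarith [hk b]
    · linarith [hk i, hd i]
    · linarith [hr' i (hA i), hd i, hv b]
    · linarith [hr' i (hA i), hd i]

end

end Mechanism

theorem truthfulUtility₂_semiAdaptive (p : Fin I.n → WithTop ℚ) (q : Fin I.n → ℚ) (i : Fin I.n) :
    (I.semiAdaptive p fun i => (q i : WithTop ℚ)).truthfulUtility₂ i =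
      (surplus I.v₂ I.prob₂ (q i) : ℝ) := by
  simp only [Mechanism.truthfulUtility₂, surplus, Mechanism.utility₂, semiAdaptive]
  push_cast
  refine Finset.sum_congr rfl fun j _ => ?_
  simp only [WithTop.coe_le_coe, decide_eq_true_eq, WithTop.untopD_coe]
  congr 1
  split_ifs with h
  · have : (q i : ℝ) ≤ I.v₂ j := Rat.cast_le.2 h
    rw [max_eq_left (by linarith)]
  · have : (I.v₂ j : ℝ) ≤ q i := Rat.cast_le.2 (not_le.1 h).le
    rw [max_eq_right (by linarith)]

theorem utility₂_semiAdaptive_le (p : Fin I.n → WithTop ℚ) (q : Fin I.n → ℚ) (i : Fin I.n)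
    (j j' : Fin I.m) :
    (I.semiAdaptive p fun i => (q i : WithTop ℚ)).utility₂ (I.v₂ j) i j' ≤
      (I.semiAdaptive p fun i => (q i : WithTop ℚ)).utility₂ (I.v₂ j) i j := by
  simp only [Mechanism.utility₂, semiAdaptive, WithTop.coe_le_coe, decide_eq_true_eq,
    WithTop.untopD_coe]
  split_ifs with h1 h2 h2
  · exact le_rfl
  · have : (I.v₂ j : ℝ) ≤ q i := Rat.cast_le.2 (not_le.1 h2).le
    linarith
  · have : (q i : ℝ) ≤ I.v₂ j := Rat.cast_le.2 h2
    linarith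
  · exact le_rfl

theorem secondRevenue_semiAdaptive (p : Fin I.n → WithTop ℚ) (q : Fin I.n → ℚ) (i : Fin I.n) :
    ∑ j, (I.prob₂ j : ℝ) * (if (I.semiAdaptive p fun i => (q i : WithTop ℚ)).x₂ i j then
      (I.semiAdaptive p fun i => (q i : WithTop ℚ)).p₂ i j else 0) =
      ((welfare I.v₂ I.prob₂ (q i) - surplus I.v₂ I.prob₂ (q i) : ℚ) : ℝ) := by
  rw [surplus_eq, sub_sub_cancel, demand, Finset.mul_sum, Rat.cast_sum]
  refine Finset.sum_congr rfl fun j _ => ?_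
  simp only [semiAdaptive, WithTop.coe_le_coe, decide_eq_true_eq, WithTop.untopD_coe]
  split_ifs <;> push_cast <;> ring

theorem semiAdaptive_incentiveCompatible (hI : I.Valid) (hind : I.IndependentDays)
    (p : Fin I.n → WithTop ℚ) (q : Fin I.n → ℚ)
    (h : ∀ i i', (I.semiAdaptive p fun i => (q i : WithTop ℚ)).utility₁ (I.v₁ i) i' +
        (surplus I.v₂ I.prob₂ (q i') : ℝ) ≤
      (I.semiAdaptive p fun i => (q i : WithTop ℚ)).utility₁ (I.v₁ i) i +
        (surplus I.v₂ I.prob₂ (q i) : ℝ)) :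
    (I.semiAdaptive p fun i => (q i : WithTop ℚ)).IncentiveCompatible := by
  intro i i' σ
  rw [Mechanism.expectedUtility_eq _ hI hind, Mechanism.expectedUtility_eq _ hI hind]
  have h' := h i i'
  rw [← truthfulUtility₂_semiAdaptive p, ← truthfulUtility₂_semiAdaptive p] at h'
  refine le_trans ?_ h'
  refine add_le_add le_rfl (Finset.sum_le_sum fun j _ => mul_le_mul_of_nonneg_left
    (utility₂_semiAdaptive_le p q i' j (σ j)) (Rat.cast_nonneg.2 (hI.prob₂_pos j).le))

/-- Optimality of the mechanism with the best levels. -/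
theorem semiAdaptive_best_isOptimal (hI : I.Valid) (hind : I.IndependentDays) {c d : ℚ}
    (h : best I.v₁ I.prob₁ I.v₂ I.prob₂ = (c, d)) :
    (∀ i, 0 ≤ price₁ I.v₁ I.v₂ I.prob₂ c d i) ∧
    (I.semiAdaptive (price₁ I.v₁ I.v₂ I.prob₂ c d)
      fun i => (price₂ I.v₁ I.v₂ I.prob₂ c d i : WithTop ℚ)).IsOptimal := by
  have hρ := hI.prob₂_pos
  obtain ⟨hc, hd, hd'⟩ : Feasible I.v₂ I.prob₂ (c, d) := by
    rw [← h]
    exact best_feasible hρ hI.v₁_nonneg hI.v₂_nonneg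
  simp only at hc hd hd'
  set p := price₁ I.v₁ I.v₂ I.prob₂ c d with hp
  set q := price₂ I.v₁ I.v₂ I.prob₂ c d with hq
  set s := fun i => surplus I.v₂ I.prob₂ (q i) with hs
  have hpos : ∀ i, d ≤ I.v₁ i + c → p i = ((s i - c : ℚ) : WithTop ℚ) := fun i hi => by
    simp only [hp, hs, hq, price₁, price₂, if_pos hi]
  have hneg : ∀ i, ¬ d ≤ I.v₁ i + c → p i = ⊤ := fun i hi => by
    simp only [hp, price₁, if_neg hi]
  have hsle : ∀ i, d ≤ I.v₁ i + c → s i ≤ I.v₁ i + c := fun i hi => by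
    simp only [hs, hq, price₂, max_eq_left hi]
    exact surplus_reserve_le hρ (hd.trans hi)
  have hseq : ∀ i, ¬ d ≤ I.v₁ i + c → s i = d := fun i hi => by
    simp only [hs, hq, price₂, max_eq_right (not_le.1 hi).le]
    exact surplus_reserve hρ hd hd'
  have hcs : ∀ i, d ≤ I.v₁ i + c → c ≤ s i := fun i hi => by
    by_cases hcap : I.v₁ i + c ≤ surplus I.v₂ I.prob₂ 0
    · have : s i = I.v₁ i + c := by
        simp only [hs, hq, price₂, max_eq_left hi]
        exact surplus_reserve hρ (hd.trans hi) hcap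
      linarith [hI.v₁_nonneg i]
    · have : q i ≤ 0 := by
        simp only [hq, price₂, max_eq_left hi]
        exact reserve_le hρ le_rfl (not_le.1 hcap).le
      exact hc.trans (surplus_antitone hρ this)
  set M := I.semiAdaptive p fun i => (q i : WithTop ℚ) with hM
  have hx : ∀ i, M.x₁ i = true ↔ d ≤ I.v₁ i + c := fun i => by
    simp only [hM, semiAdaptive, decide_eq_true_eq]
    by_cases hi : d ≤ I.v₁ i + c
    · rw [hpos i hi, WithTop.coe_le_coe]
      simp only [hi, iff_true]
      linarith [hsle i hi]
    · simp [hneg i hi, hi]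
  have hp₁ : ∀ i, d ≤ I.v₁ i + c → M.p₁ i = s i - c := fun i hi => by
    simp only [hM, semiAdaptive, hpos i hi, WithTop.untopD_coe]
    push_cast
    rfl
  refine ⟨fun i => ?_, semiAdaptive_incentiveCompatible hI hind p q fun i i' => ?_, ⟨?_, ?_⟩,
    fun M' hIC hIR => (Mechanism.revenue_le_objective_best hI hind hIC hIR).trans_eq ?_⟩
  · by_cases hi : d ≤ I.v₁ i + c
    · rw [hpos i hi]
      exact_mod_cast sub_nonneg.2 (hcs i hi)
    · rw [hneg i hi]
      exact le_top
  · have hu : ∀ i i', M.utility₁ (I.v₁ i) i' + (s i' : ℝ) =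
        ((if d ≤ I.v₁ i' + c then I.v₁ i + c else d : ℚ) : ℝ) := fun i i' => by
      by_cases hi : d ≤ I.v₁ i' + c
      · rw [Mechanism.utility₁, if_pos ((hx i').2 hi), hp₁ i' hi, if_pos hi]
        push_cast
        ring
      · rw [Mechanism.utility₁, if_neg fun h => hi ((hx i').1 h), if_neg hi, hseq i' hi, zero_add]
    change M.utility₁ (I.v₁ i) i' + (s i' : ℝ) ≤ M.utility₁ (I.v₁ i) i + (s i : ℝ)
    rw [hu, hu, Rat.cast_le]
    split_ifs with h1 h2 h2 <;> linarith
  · intro i hi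
    have hi := (hx i).1 hi
    rw [hp₁ i hi]
    have : (s i : ℝ) ≤ ((I.v₁ i + c : ℚ) : ℝ) := Rat.cast_le.2 (hsle i hi)
    push_cast at this
    linarith
  · intro i j hj
    simp only [hM, semiAdaptive, decide_eq_true_eq, WithTop.coe_le_coe] at hj
    simp only [hM, semiAdaptive, WithTop.untopD_coe]
    exact Rat.cast_le.2 hj
  · rw [Mechanism.revenue_eq _ hI hind, h, objective, Rat.cast_sum]
    refine Finset.sum_congr rfl fun i _ => ?_
    rw [Rat.cast_mul, Mechanism.typeRevenue, secondRevenue_semiAdaptive]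
    congr 1
    by_cases hi : d ≤ I.v₁ i + c
    · rw [if_pos ((hx i).2 hi), hp₁ i hi]
      simp only [if_pos hi]
      push_cast
      simp only [hs, hq, price₂]
      ring
    · rw [if_neg fun h => hi ((hx i).1 h)]
      have e : surplus I.v₂ I.prob₂ (q i) = d := hseq i hi
      simp only [if_neg hi]
      rw [e, Rat.cast_sub, Rat.cast_sub, zero_add]
      rfl

end TwoDayAuction

/-! ## The algorithm -/

namespace ListAuction

/-- `SecondDay.surplus` for a list of pairs of a valuation and its probability. -/
def surplus (l : List (ℚ × ℚ)) (q : ℚ) : ℚ := (l.map fun y => y.2 * max (y.1 - q) 0).sum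

/-- `SecondDay.demand` for a list of pairs of a valuation and its probability. -/
def demand (l : List (ℚ × ℚ)) (q : ℚ) : ℚ := (l.map fun y => if q ≤ y.1 then y.2 else 0).sum

/-- `SecondDay.welfare` for a list of pairs of a valuation and its probability. -/
def welfare (l : List (ℚ × ℚ)) (q : ℚ) : ℚ :=
  (l.map fun y => if q ≤ y.1 then y.2 * y.1 else 0).sum

/-- `SecondDay.reserve` for a list of pairs of a valuation and its probability. -/
def reserve (l : List (ℚ × ℚ)) (u : ℚ) : ℚ :=
  argmax (fun x => x) 0 (l.map fun y => (welfare l y.1 - u) / demand l y.1)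

/-- `TwoLevel.objective` for lists of pairs of a valuation and its probability. -/
def objective (k l : List (ℚ × ℚ)) (x : ℚ × ℚ) : ℚ :=
  (k.map fun y => y.2 * (welfare l (reserve l (max (y.1 + x.1) x.2)) -
    if x.2 ≤ y.1 + x.1 then x.1 else x.2)).sum

/-- `TwoLevel.bestGiven` for lists of pairs of a valuation and its probability. -/
def bestGiven (k l : List (ℚ × ℚ)) (c : ℚ) : ℚ × ℚ :=
  argmax (objective k l)
    (argmax (objective k l) (0, 0) (l.map fun y => (c, surplus l y.1)))
    (k.map fun y => (c, max 0 (min (c + y.1) (surplus l 0))))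

/-- `TwoLevel.best` for lists of pairs of a valuation and its probability. -/
def best (k l : List (ℚ × ℚ)) : ℚ × ℚ :=
  argmax (objective k l) (0, 0) (k.map fun y =>
    argmax (objective k l) (0, 0) (l.map fun z => bestGiven k l (surplus l z.1 - y.1)))

/-- The list of the prices `TwoLevel.price₁` and `TwoLevel.price₂` of all types. -/
def schedule (k l : List (ℚ × ℚ)) (x : ℚ × ℚ) : List (WithTop ℚ × WithTop ℚ) :=
  k.map fun y => (if x.2 ≤ y.1 + x.1 then
      ((surplus l (reserve l (max (y.1 + x.1) x.2)) - x.1 : ℚ) : WithTop ℚ) else ⊤,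
    ((reserve l (max (y.1 + x.1) x.2) : ℚ) : WithTop ℚ))

/-- The prices of the optimal mechanism, for the two lists of valuations and the table of joint
probabilities. -/
def solve (a : List ℚ × List ℚ × List (List ℚ)) : List (WithTop ℚ × WithTop ℚ) :=
  let k := a.1.zip (a.2.2.map List.sum)
  let l := a.2.1.zip ((a.2.2.headD []).map fun x => x / (a.2.2.headD []).sum)
  schedule k l (best k l)

section PolyTime

open PolyTime

variable {δ : Type} [HasRep δ] {k l : δ → List (ℚ × ℚ)} {q : δ → ℚ} {x : δ → ℚ × ℚ}

theorem surplus_polyTime (hl : PolyTime l) (hq : PolyTime q) :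
    PolyTime fun t => surplus (l t) (q t) := by
  have hq' : PolyTime fun p : δ × (ℚ × ℚ) => q p.1 := hq.comp fst
  have hy : PolyTime fun p : δ × (ℚ × ℚ) => p.2.1 := fst.comp snd
  have hp : PolyTime fun p : δ × (ℚ × ℚ) => p.2.2 := snd.comp snd
  have h := mul hp (ratMax (sub hy hq') zero)
  exact sum (map (f := fun (t : δ) (y : ℚ × ℚ) => y.2 * max (y.1 - q t) 0) hl h)

theorem demand_polyTime (hl : PolyTime l) (hq : PolyTime q) :
    PolyTime fun t => demand (l t) (q t) := by
  have hq' : PolyTime fun p : δ × (ℚ × ℚ) => q p.1 := hq.comp fst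
  have hy : PolyTime fun p : δ × (ℚ × ℚ) => p.2.1 := fst.comp snd
  have hp : PolyTime fun p : δ × (ℚ × ℚ) => p.2.2 := snd.comp snd
  have h := ite_le hq' hy hp zero
  exact sum (map (f := fun (t : δ) (y : ℚ × ℚ) => if q t ≤ y.1 then y.2 else 0) hl h)

theorem welfare_polyTime (hl : PolyTime l) (hq : PolyTime q) :
    PolyTime fun t => welfare (l t) (q t) := by
  have hq' : PolyTime fun p : δ × (ℚ × ℚ) => q p.1 := hq.comp fst
  have hy : PolyTime fun p : δ × (ℚ × ℚ) => p.2.1 := fst.comp snd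
  have hp : PolyTime fun p : δ × (ℚ × ℚ) => p.2.2 := snd.comp snd
  have h := ite_le hq' hy (mul hp hy) zero
  exact sum (map (f := fun (t : δ) (y : ℚ × ℚ) => if q t ≤ y.1 then y.2 * y.1 else 0) hl h)

theorem reserve_polyTime (hl : PolyTime l) (hq : PolyTime q) :
    PolyTime fun t => reserve (l t) (q t) := by
  have hl' : PolyTime fun p : δ × (ℚ × ℚ) => l p.1 := hl.comp fst
  have hq' : PolyTime fun p : δ × (ℚ × ℚ) => q p.1 := hq.comp fst
  have hy : PolyTime fun p : δ × (ℚ × ℚ) => p.2.1 := fst.comp snd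
  have h := div (sub (welfare_polyTime hl' hy) hq') (demand_polyTime hl' hy)
  have h' := map (f := fun (t : δ) (y : ℚ × ℚ) => (welfare (l t) y.1 - q t) / demand (l t) y.1) hl h
  have hid : PolyTime fun p : δ × ℚ => p.2 := snd
  unfold reserve
  exact argmax_polyTime (f := fun (_ : δ) (x : ℚ) => x) hid zero h'

theorem objective_polyTime (hk : PolyTime k) (hl : PolyTime l) (hx : PolyTime x) :
    PolyTime fun t => objective (k t) (l t) (x t) := by
  have hl' : PolyTime fun p : δ × (ℚ × ℚ) => l p.1 := hl.comp fst
  have hx' : PolyTime fun p : δ × (ℚ × ℚ) => x p.1 := hx.comp fst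
  have hc : PolyTime fun p : δ × (ℚ × ℚ) => (x p.1).1 := fst.comp hx'
  have hd : PolyTime fun p : δ × (ℚ × ℚ) => (x p.1).2 := snd.comp hx'
  have hy : PolyTime fun p : δ × (ℚ × ℚ) => p.2.1 := fst.comp snd
  have hp : PolyTime fun p : δ × (ℚ × ℚ) => p.2.2 := snd.comp snd
  have hw := welfare_polyTime hl' (reserve_polyTime hl' (ratMax (add hy hc) hd))
  have h := mul hp (sub hw (ite_le hd (add hy hc) hc hd))
  unfold objective
  exact sum (map (hl := hk) (f := fun (t : δ) (y : ℚ × ℚ) => y.2 * (welfare (l t) (reserve (l t)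
      (max (y.1 + (x t).1) (x t).2)) - if (x t).2 ≤ y.1 + (x t).1 then (x t).1 else (x t).2)) h)

theorem bestGiven_polyTime (hk : PolyTime k) (hl : PolyTime l) (hq : PolyTime q) :
    PolyTime fun t => bestGiven (k t) (l t) (q t) := by
  have hl' : PolyTime fun p : δ × (ℚ × ℚ) => l p.1 := hl.comp fst
  have hk' : PolyTime fun p : δ × (ℚ × ℚ) => k p.1 := hk.comp fst
  have hq' : PolyTime fun p : δ × (ℚ × ℚ) => q p.1 := hq.comp fst
  have hy : PolyTime fun p : δ × (ℚ × ℚ) => p.2.1 := fst.comp snd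
  have h : PolyTime fun p : δ × (ℚ × ℚ) => objective (k p.1) (l p.1) p.2 :=
    objective_polyTime hk' hl' snd
  have h1 := map (hl := hl) (f := fun (t : δ) (y : ℚ × ℚ) => (q t, surplus (l t) y.1))
    (pair hq' (surplus_polyTime hl' hy))
  have h2 := map (hl := hk) (f := fun (t : δ) (y : ℚ × ℚ) => (q t, max 0 (min (q t + y.1) (surplus (l t) 0))))
    (pair hq' (ratMax zero (ratMin (add hq' hy) (surplus_polyTime hl' zero))))
  unfold bestGiven
  exact argmax_polyTime (f := fun t => objective (k t) (l t)) h (argmax_polyTime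
    (f := fun t => objective (k t) (l t)) h (pair zero zero) h1) h2

theorem best_polyTime (hk : PolyTime k) (hl : PolyTime l) :
    PolyTime fun t => best (k t) (l t) := by
  have hl' : PolyTime fun p : δ × (ℚ × ℚ) => l p.1 := hl.comp fst
  have hk' : PolyTime fun p : δ × (ℚ × ℚ) => k p.1 := hk.comp fst
  have hl'' : PolyTime fun p : (δ × (ℚ × ℚ)) × (ℚ × ℚ) => l p.1.1 := hl'.comp fst
  have hk'' : PolyTime fun p : (δ × (ℚ × ℚ)) × (ℚ × ℚ) => k p.1.1 := hk'.comp fst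
  have hy : PolyTime fun p : δ × (ℚ × ℚ) => p.2.1 := fst.comp snd
  have hy' : PolyTime fun p : (δ × (ℚ × ℚ)) × (ℚ × ℚ) => p.1.2.1 := hy.comp fst
  have hz : PolyTime fun p : (δ × (ℚ × ℚ)) × (ℚ × ℚ) => p.2.1 := fst.comp snd
  have ho : PolyTime fun p : δ × (ℚ × ℚ) => objective (k p.1) (l p.1) p.2 :=
    objective_polyTime hk' hl' snd
  have ho' : PolyTime fun p : (δ × (ℚ × ℚ)) × (ℚ × ℚ) => objective (k p.1.1) (l p.1.1) p.2 :=
    objective_polyTime hk'' hl'' snd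
  have h1 : PolyTime fun p : δ × (ℚ × ℚ) => (l p.1).map fun z =>
      bestGiven (k p.1) (l p.1) (surplus (l p.1) z.1 - p.2.1) :=
    map (f := fun (p : δ × (ℚ × ℚ)) (z : ℚ × ℚ) =>
      bestGiven (k p.1) (l p.1) (surplus (l p.1) z.1 - p.2.1)) hl'
      (bestGiven_polyTime hk'' hl'' (sub (surplus_polyTime hl'' hz) hy'))
  have h2 : PolyTime fun p : δ × (ℚ × ℚ) => argmax (objective (k p.1) (l p.1)) (0, 0)
      ((l p.1).map fun z => bestGiven (k p.1) (l p.1) (surplus (l p.1) z.1 - p.2.1)) :=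
    argmax_polyTime (f := fun p : δ × (ℚ × ℚ) => objective (k p.1) (l p.1))
      ho' (pair zero zero) h1
  have h3 : PolyTime fun t => (k t).map fun y => argmax (objective (k t) (l t)) (0, 0)
      ((l t).map fun z => bestGiven (k t) (l t) (surplus (l t) z.1 - y.1)) :=
    map (f := fun (t : δ) (y : ℚ × ℚ) => argmax (objective (k t) (l t)) ((0 : ℚ), (0 : ℚ))
      (List.map (fun z : ℚ × ℚ => bestGiven (k t) (l t) (surplus (l t) z.1 - y.1)) (l t))) hk h2
  unfold best
  exact argmax_polyTime (f := fun t => objective (k t) (l t))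
    ho (pair zero zero) h3

theorem schedule_polyTime (hk : PolyTime k) (hl : PolyTime l) (hx : PolyTime x) :
    PolyTime fun t => schedule (k t) (l t) (x t) := by
  have hl' : PolyTime fun p : δ × (ℚ × ℚ) => l p.1 := hl.comp fst
  have hx' : PolyTime fun p : δ × (ℚ × ℚ) => x p.1 := hx.comp fst
  have hc : PolyTime fun p : δ × (ℚ × ℚ) => (x p.1).1 := fst.comp hx'
  have hd : PolyTime fun p : δ × (ℚ × ℚ) => (x p.1).2 := snd.comp hx'
  have hy : PolyTime fun p : δ × (ℚ × ℚ) => p.2.1 := fst.comp snd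
  have hr := reserve_polyTime hl' (ratMax (add hy hc) hd)
  have h := pair (ite_le hd (add hy hc)
    (coe_withTop (sub (surplus_polyTime hl' hr) hc)) top) (coe_withTop hr)
  unfold schedule
  exact map (hl := hk) (f := fun (t : δ) (y : ℚ × ℚ) => (if (x t).2 ≤ y.1 + (x t).1 then
      ((surplus (l t) (reserve (l t) (max (y.1 + (x t).1) (x t).2)) - (x t).1 : ℚ) : WithTop ℚ)
      else ⊤,
    ((reserve (l t) (max (y.1 + (x t).1) (x t).2) : ℚ) : WithTop ℚ))) h

theorem solve_polyTime : PolyTime solve := by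
  have hrow : PolyTime fun a : List ℚ × List ℚ × List (List ℚ) => a.2.2.headD [] :=
    headD_nil.comp (snd.comp snd)
  have hk : PolyTime fun a : List ℚ × List ℚ × List (List ℚ) => a.1.zip (a.2.2.map List.sum) :=
    zip fst (map (snd.comp snd) (f := fun _ => List.sum) (sum snd))
  have hl : PolyTime fun a : List ℚ × List ℚ × List (List ℚ) =>
      a.2.1.zip ((a.2.2.headD []).map fun x => x / (a.2.2.headD []).sum) :=
    zip (fst.comp snd) (map hrow (f := fun a x => x / (a.2.2.headD []).sum)
      (snd.div (sum (hrow.comp fst))))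
  exact schedule_polyTime hk hl (best_polyTime hk hl)

end PolyTime

section OfFn

variable {n m : ℕ} (v π : Fin n → ℚ) (w ρ : Fin m → ℚ)

theorem zip_ofFn {A B : Type} (f : Fin n → A) (g : Fin n → B) :
    (List.ofFn f).zip (List.ofFn g) = List.ofFn fun i => (f i, g i) :=
  List.ext_getElem (by simp) fun i h1 h2 => by simp

theorem surplus_ofFn (q : ℚ) :
    surplus (List.ofFn fun j => (w j, ρ j)) q = SecondDay.surplus w ρ q := by
  simp only [surplus, SecondDay.surplus, List.map_ofFn, List.sum_ofFn, Function.comp_apply]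

theorem demand_ofFn (q : ℚ) :
    demand (List.ofFn fun j => (w j, ρ j)) q = SecondDay.demand w ρ q := by
  simp only [demand, SecondDay.demand, List.map_ofFn, List.sum_ofFn, Function.comp_apply]

theorem welfare_ofFn (q : ℚ) :
    welfare (List.ofFn fun j => (w j, ρ j)) q = SecondDay.welfare w ρ q := by
  simp only [welfare, SecondDay.welfare, List.map_ofFn, List.sum_ofFn, Function.comp_apply]

theorem reserve_ofFn (u : ℚ) :
    reserve (List.ofFn fun j => (w j, ρ j)) u = SecondDay.reserve w ρ u := by
  simp only [reserve, SecondDay.reserve, List.map_ofFn, welfare_ofFn, demand_ofFn,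
    Function.comp_def]

theorem objective_ofFn : objective (List.ofFn fun i => (v i, π i)) (List.ofFn fun j => (w j, ρ j)) =
    TwoLevel.objective v π w ρ := by
  funext x
  simp only [objective, TwoLevel.objective, List.map_ofFn, List.sum_ofFn, welfare_ofFn,
    reserve_ofFn, Function.comp_apply]

theorem bestGiven_ofFn (c : ℚ) :
    bestGiven (List.ofFn fun i => (v i, π i)) (List.ofFn fun j => (w j, ρ j)) c =
      TwoLevel.bestGiven v π w ρ c := by
  simp only [bestGiven, TwoLevel.bestGiven, List.map_ofFn, objective_ofFn, surplus_ofFn,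
    Function.comp_def]

theorem best_ofFn : best (List.ofFn fun i => (v i, π i)) (List.ofFn fun j => (w j, ρ j)) =
    TwoLevel.best v π w ρ := by
  simp only [best, TwoLevel.best, List.map_ofFn, objective_ofFn, surplus_ofFn, bestGiven_ofFn,
    Function.comp_def]

theorem schedule_ofFn (c d : ℚ) :
    schedule (List.ofFn fun i => (v i, π i)) (List.ofFn fun j => (w j, ρ j)) (c, d) =
      List.ofFn fun i => (TwoLevel.price₁ v w ρ c d i,
        (TwoLevel.price₂ v w ρ c d i : WithTop ℚ)) := by
  simp only [schedule, TwoLevel.price₁, TwoLevel.price₂, List.map_ofFn, surplus_ofFn, reserve_ofFn,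
    Function.comp_def]

end OfFn

end ListAuction

/-! ## Input and output -/

theorem Data.rep_ofRat (r : ℚ) : rep (Data.ofRat r) r :=
  ⟨r.num, r.den, rfl, by exact_mod_cast r.pos, by exact_mod_cast (Rat.num_div_den r).symm⟩

theorem Data.rep_ofList {α β : Type} [HasRep α] {e : β → Data} {f : β → α}
    (h : ∀ b, rep (e b) (f b)) (l : List β) : rep (Data.ofList (l.map e)) (l.map f) := by
  induction l with
  | nil => exact (rfl : Data.int 0 = Data.int 0)
  | cons b l ih => exact ⟨_, _, rfl, h b, ih⟩

theorem Data.rep_ofFn {α : Type} [HasRep α] {n : ℕ} {e : Fin n → Data} {f : Fin n → α}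
    (h : ∀ i, rep (e i) (f i)) : rep (Data.ofList (List.ofFn e)) (List.ofFn f) := by
  rw [List.ofFn_eq_map, List.ofFn_eq_map]
  exact Data.rep_ofList h _

theorem Data.exists_of_rep_ofFn {α : Type} [HasRep α] {n : ℕ} {f : Fin n → α} {y : Data}
    (h : rep y (List.ofFn f)) :
    ∃ e : Fin n → Data, (∀ i, rep (e i) (f i)) ∧ y = Data.ofList (List.ofFn e) := by
  induction n generalizing y with
  | zero =>
    rw [List.ofFn_zero] at h
    exact ⟨fun i => i.elim0, fun i => i.elim0, by rw [List.ofFn_zero]; exact h⟩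
  | succ n ih =>
    rw [List.ofFn_succ] at h
    obtain ⟨a, z, rfl, ha, hz⟩ := h
    obtain ⟨e, he, rfl⟩ := ih hz
    refine ⟨Fin.cons a e, fun i => ?_, ?_⟩
    · cases i using Fin.cases with
      | zero => exact ha
      | succ i => exact he i
    · rw [List.ofFn_succ]
      rfl

namespace TwoDayAuction

variable (I : TwoDayAuction)

theorem rep_encode : rep I.encode
    (List.ofFn I.v₁, List.ofFn I.v₂, List.ofFn fun i => List.ofFn (I.prob i)) :=
  ⟨_, _, rfl, Data.rep_ofFn fun _ => Data.rep_ofRat _, _, _, rfl,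
    Data.rep_ofFn fun _ => Data.rep_ofRat _,
    Data.rep_ofFn fun _ => Data.rep_ofFn fun _ => Data.rep_ofRat _⟩

variable {I}

theorem solve_eq (hI : I.Valid) (hind : I.IndependentDays) :
    ListAuction.solve (List.ofFn I.v₁, List.ofFn I.v₂, List.ofFn fun i => List.ofFn (I.prob i)) =
      ListAuction.schedule (List.ofFn fun i => (I.v₁ i, I.prob₁ i))
        (List.ofFn fun j => (I.v₂ j, I.prob₂ j)) (TwoLevel.best I.v₁ I.prob₁ I.v₂ I.prob₂) := by
  have hk : (List.ofFn I.v₁).zip ((List.ofFn fun i => List.ofFn (I.prob i)).map List.sum) =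
      List.ofFn fun i => (I.v₁ i, I.prob₁ i) := by
    rw [List.map_ofFn, ListAuction.zip_ofFn]
    simp only [Function.comp_apply, List.sum_ofFn, prob₁]
  have hl : (List.ofFn I.v₂).zip (((List.ofFn fun i => List.ofFn (I.prob i)).headD []).map
      fun x => x / ((List.ofFn fun i => List.ofFn (I.prob i)).headD []).sum) =
      List.ofFn fun j => (I.v₂ j, I.prob₂ j) := by
    have hn : 0 < I.n := by
      by_contra h
      have : IsEmpty (Fin I.n) := by
        rw [Nat.eq_zero_of_not_pos h]
        infer_instance
      have := hI.prob_sum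
      simp at this
    have hhead : (List.ofFn fun i => List.ofFn (I.prob i)).headD [] =
        List.ofFn (I.prob ⟨0, hn⟩) := by
      rw [List.headD_eq_head?_getD, List.head?_eq_getElem?]
      simp [hn]
    rw [hhead, List.map_ofFn, ListAuction.zip_ofFn, List.sum_ofFn]
    simp only [Function.comp_apply]
    congr 1
    funext j
    rw [← prob_div_prob₁ hI hind ⟨0, hn⟩ j]
    rfl
  simp only [ListAuction.solve, hk, hl, ListAuction.best_ofFn]

theorem isSolution_of_rep_solve (hI : I.Valid) (hind : I.IndependentDays) {y : Data}
    (hy : rep y (ListAuction.solve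
      (List.ofFn I.v₁, List.ofFn I.v₂, List.ofFn fun i => List.ofFn (I.prob i)))) :
    I.IsSolution y := by
  rcases h : TwoLevel.best I.v₁ I.prob₁ I.v₂ I.prob₂ with ⟨c, d⟩
  rw [solve_eq hI hind, h, ListAuction.schedule_ofFn] at hy
  obtain ⟨e, he, rfl⟩ := Data.exists_of_rep_ofFn hy
  obtain ⟨hp, hopt⟩ := semiAdaptive_best_isOptimal hI hind h
  choose a b hab ha hb using he
  refine ⟨_, _, ⟨a, b, fun i => ⟨ha i, hb i⟩, ?_⟩, fun i => ⟨hp i, ?_⟩, hopt⟩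
  · rw [funext hab]
  · exact WithTop.coe_le_coe.2 (SecondDay.reserve_nonneg _)

end TwoDayAuction

theorem mainTheorem4 :
    SolvableInPolyTime TwoDayAuction.encode
      (fun I : TwoDayAuction => I.Valid ∧ I.IndependentDays)
      (fun (I : TwoDayAuction) (y : Data) => I.IsSolution y) := by
  obtain ⟨f, P, h⟩ := ListAuction.solve_polyTime
  refine ⟨f, P, fun I hI => ?_⟩
  obtain ⟨y, t, h1, h2, h3⟩ := h _ _ I.rep_encode
  exact ⟨y, t, h1, by omega, TwoDayAuction.isSolution_of_rep_solve hI.1 hI.2 h3⟩
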